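/- **Setting.** Let $H$ be a separable real reproducing kernel Hilbert space of functions on a measurable space $\mathcal X$ with measurable kernel $k$, and let $\nu$ be a probability measure on $\mathcal X$ with $\int k(x,x)\,d\nu(x)<\infty$. Put $Cf=\int k(\cdot,x')f(x')\,d\nu(x')$ for $f\in H$ and $r(x,x')=\int k(x,z)k(z,x')\,d\nu(z)$. Let $\Pi=\mathcal N(0,C)$ be the centred Gaussian measure on $H$ with covariance operator $C$, and $F\sim\Pi$. For a normed space $E$, $\mathcal P_2(E)$ denotes the Borel probability measures on $E$ with finite second moment. Fix $x_1,\dots,x_N\in\mathcal X$ and write $f(x_{1:N})=(f(x_1),\dots,f(x_N))$. Let $p(y\mid f)=\exp(-\ell_N(y,f(x_{1:N})))$ be a likelihood with respect to a $\sigma$-finite measure $\mu$ on $\mathbb R^N$: $\ell_N:\mathbb R^N\times\mathbb R^N\to\mathbb R$ is measurable and $\int p(y\mid f)\,d\mu(y)=1$ for all $f\in H$. The Bayes posterior $\Pi_{\mathrm B}$ given $y$ is the measure with $d\Pi_{\mathrm B}/d\Pi\,(f)=p(y\mid f)/\int p(y\mid g)\,d\Pi(g)$. For $h_1,\dots,h_M\in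 H$ let $U=(\langle F,h_m\rangle)_{m=1}^M$, and let $\mathbb P(F\in\cdot\mid U=u)$, $u\in\mathbb R^M$, be a regular conditional distribution of $F$ given $U$ that is concentrated on $\{f\in H:(\langle f,h_m\rangle)_m=u\}$ for every $u$. Put $\Pi_\tau=\int\mathbb P(F\in\cdot\mid U=u)\,d\tau(u)$ and $\mathcal Q_M=\{\Pi_\tau:\tau\in\mathcal P_2(\mathbb R^M)\}$. **Theorem.** For $\mu$-almost every $y$, $\Pi_{\mathrm B}$ is a well-defined element of $\mathcal P_2(H)$. For every $y$ for which this is so, writing $\ell_N$ for $\ell_N(y,\cdot)$, the following hold. (a) Let $e_1,\dots,e_M$ be orthonormal eigenfunctions of $C$ with eigenvalues $\lambda_1,\dots,\lambda_M>0$ (for instance those of the $M$ largest eigenvalues), let $h_m=e_m$, so that $U=F^{1:M}$ consists of the corresponding Karhunen–Loève coefficients, and put $\Lambda_M=\operatorname{diag}(\lambda_1,\dots,\lambda_M)$, $e^{1:M}(x_{1:N})=(e_m(x_n))_{m,n}\in\mathbb R^{M\times N}$, $$\mu_u(x_{1:N})=e^{1:M}(x_{1:N})^\top u,\qquad \Sigma(x_{1:N})=r(x_{1:N},x_{1:N})-e^{1:M}(x_{1:N})^\top\Lambda_M\,e^{1:M}(x_{1:N}),$$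 $$V^*(u)=\mathbb E_{\xi\sim\mathcal N(0,I_N)}\Big[\ell_N\big(\mu_u(x_{1:N})+\sqrt{\Sigma(x_{1:N})}\,\xi\big)\Big]+\tfrac12u^\top\Lambda_M^{-1}u .$$ Assume that the expectation is well defined and finite for every $u\in\mathbb R^M$. Then conditional laws as above exist, and for any choice of them: the probability measure $\tau^*$ on $\mathbb R^M$ with Lebesgue density proportional to $\exp(-V^*)$ exists and lies in $\mathcal P_2(\mathbb R^M)$, and $\Pi_{\tau^*}$ is the unique minimiser of $Q\mapsto\mathrm{KL}(Q,\Pi_{\mathrm B})$ over $\mathcal Q_M$. (b) The same holds for arbitrary $h_1,\dots,h_M\in H$ for which the matrix $\langle Ch,h\rangle=(\langle Ch_m,h_{m'}\rangle)_{m,m'}$ is invertible, with $$V^*(u)=\mathbb E_{\xi\sim\mathcal N(0,I_N)}\Big[\ell_N\big(\mu_u(x_{1:N})+\sqrt{\Sigma(x_{1:N})}\,\xi\big)\Big]+\tfrac12u^\top\langle Ch,h\rangle^{-1}u,$$ $$\mu_u(x_{1:N})=\mathbb C[F(x_{1:N}),U]\,\mathbb C[U,U]^{-1}u,$$ $$\Sigma(x_{1:N})=\mathbb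 C[F(x_{1:N}),F(x_{1:N})]-\mathbb C[F(x_{1:N}),U]\,\mathbb C[U,U]^{-1}\,\mathbb C[U,F(x_{1:N})],$$ where $\mathbb C$ denotes covariance matrices. -/

import Mathlib

open MeasureTheory ProbabilityTheory InformationTheory
open scoped ENNReal MatrixOrder RealInnerProductSpace

namespace GREApprox

noncomputable section

/-! ### Reproducing kernel Hilbert space, covariance operator and prior -/

section RKHS

variable {X : Type*} (H : Type*) [NormedAddCommGroup H] [InnerProductSpace ℝ H] [CompleteSpace H]
  [RKHS ℝ H X ℝ]

/-- The scalar reproducing kernel `k(x, x')` of `H`. -/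
def ker (x x' : X) : ℝ := RKHS.kernel H x x' 1

/-- The kernel section `k(·, x)` as an element of `H`. -/
def kerSection (x : X) : H := RKHS.kerFun H x 1

variable {H} in
/-- Sanity check: the kernel section represents point evaluation. -/
theorem inner_kerSection (f : H) (x : X) : ⟪f, kerSection H x⟫ = f x := by
  simp [kerSection]

/-- Sanity check: the kernel section at `x'` is the function `k(·, x')`. -/
theorem kerSection_apply (x x' : X) : kerSection H x' x = ker H x x' := by
  simp [kerSection, ker, RKHS.kerFun_apply]

/-- The kernel `r(x, x') = ∫ k(x, z) k(z, x') dν(z)`. -/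
def smoothedKer [MeasurableSpace X] (ν : Measure X) (x x' : X) : ℝ :=
  ∫ z, ker H x z * ker H z x' ∂ν

variable {H}

/-- The operator `C f = ∫ k(·, z) f(z) dν(z)` (a Bochner integral in `H`). -/
def covOp [MeasurableSpace X] (ν : Measure X) (f : H) : H :=
  ∫ z, f z • kerSection H z ∂ν

/-- `P = N(0, C)`: a centred Gaussian measure on `H` with covariance operator `C = covOp ν`.
(`covarianceOperator` is uncentred, which makes no difference for mean zero.) -/
structure IsPrior [MeasurableSpace H] [BorelSpace H] [MeasurableSpace X]
    (ν : Measure X) (P : Measure H) : Prop where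
  isGaussian : IsGaussian P
  mean_eq_zero : ∫ f, f ∂P = 0
  covariance_eq : ∀ h : H, covarianceOperator P h = covOp ν h

/-- Evaluation at the points `x₁, …, x_N`: `f ↦ (f(x₁), …, f(x_N))`. -/
def evalAt {N : ℕ} (x : Fin N → X) (f : H) : EuclideanSpace ℝ (Fin N) :=
  WithLp.toLp 2 fun n => f (x n)

end RKHS

section Hilbert

variable {H : Type*} [NormedAddCommGroup H] [InnerProductSpace ℝ H]

/-- The features `U(f) = (⟨f, h₁⟩, …, ⟨f, h_M⟩)`. -/
def features {M : ℕ} (h : Fin M → H) (f : H) : EuclideanSpace ℝ (Fin M) :=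
  WithLp.toLp 2 fun m => ⟪f, h m⟫

end Hilbert

/-! ### Posterior, conditional laws and the variational family -/

/-- A Borel probability measure with finite second moment. -/
def IsP2 {E : Type*} [NormedAddCommGroup E] [MeasurableSpace E] (Q : Measure E) : Prop :=
  IsProbabilityMeasure Q ∧ ∫⁻ v, ‖v‖ₑ ^ 2 ∂Q < ∞

/-- The Bayes posterior with prior `P` and negative log-likelihood `L`:
`dΠ_B / dP = exp (-L) / ∫ exp (-L) dP`. It is a probability measure when the normalising
constant is positive and finite, and the zero measure when that constant is infinite. -/
def posterior {H : Type*} [MeasurableSpace H] (P : Measure H) (L : H → ℝ) : Measure H :=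
  (∫⁻ f, ENNReal.ofReal (Real.exp (-L f)) ∂P)⁻¹ •
    P.withDensity fun f => ENNReal.ofReal (Real.exp (-L f))

/-- `κ` is the conditional law `u ↦ ℙ(F ∈ · | U(F) = u)` for `F ∼ P`: a Markov kernel that
disintegrates the joint law of `(U(F), F)` over the law of `U(F)` and that is carried, for every
`u`, by the fibre `{U = u}`. The last clause matters because the kernel is also mixed over
measures `τ` that are singular to the law of `U(F)`, for which a version of the conditional law
that is arbitrary on null sets would have no meaning. -/
structure IsCondLaw {H E : Type*} [MeasurableSpace H] [MeasurableSpace E]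
    (P : Measure H) (U : H → E) (κ : Kernel E H) : Prop where
  isMarkov : IsMarkovKernel κ
  disintegration : P.map (fun f => (U f, f)) = (P.map U) ⊗ₘ κ
  fibre : ∀ u, κ u {f | U f ≠ u} = 0

/-- The mixture `Π_τ = ∫ ℙ(F ∈ · | U = u) dτ(u)`. -/
def mixture {H E : Type*} [MeasurableSpace H] [MeasurableSpace E]
    (κ : Kernel E H) (τ : Measure E) : Measure H :=
  τ.bind κ

/-- The variational family `{Π_τ : τ ∈ 𝒫₂(E)}`. -/
def family {H E : Type*} [MeasurableSpace H] [NormedAddCommGroup E] [MeasurableSpace E]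
    (κ : Kernel E H) : Set (Measure H) :=
  {Q | ∃ τ : Measure E, IsP2 τ ∧ Q = mixture κ τ}

/-- `Q₀` is the unique minimiser of `Q ↦ KL(Q, R)` over the set `𝒬`. -/
def IsKLArgmin {H : Type*} [MeasurableSpace H] (𝒬 : Set (Measure H)) (R Q₀ : Measure H) : Prop :=
  Q₀ ∈ 𝒬 ∧ ∀ Q ∈ 𝒬, Q ≠ Q₀ → klDiv Q₀ R < klDiv Q R

/-! ### The potential and its Gibbs measure -/

/-- `z(u, ξ) = A u + √S ξ`. -/
def gaussPoint {N M : ℕ} (A : Matrix (Fin N) (Fin M) ℝ) (S : Matrix (Fin N) (Fin N) ℝ)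
    (u : EuclideanSpace ℝ (Fin M)) (ξ : EuclideanSpace ℝ (Fin N)) : EuclideanSpace ℝ (Fin N) :=
  WithLp.toLp 2 (A.mulVec u.ofLp) + Matrix.toEuclideanCLM (𝕜 := ℝ) (CFC.sqrt S) ξ

/-- `E_ξ[ℓ(A u + √S ξ)]`, `ξ ∼ N(0, I_N)`, is well defined and finite for every `u`. -/
def FiniteExpectedLoss {N M : ℕ} (ℓ : EuclideanSpace ℝ (Fin N) → ℝ)
    (A : Matrix (Fin N) (Fin M) ℝ) (S : Matrix (Fin N) (Fin N) ℝ) : Prop :=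
  ∀ u : EuclideanSpace ℝ (Fin M),
    Integrable (fun ξ => ℓ (gaussPoint A S u ξ)) (stdGaussian (EuclideanSpace ℝ (Fin N)))

/-- `V(u) = E_ξ[ℓ(A u + √S ξ)] + ½ uᵀ G⁻¹ u`, `ξ ∼ N(0, I_N)`. -/
def potential {N M : ℕ} (ℓ : EuclideanSpace ℝ (Fin N) → ℝ)
    (A : Matrix (Fin N) (Fin M) ℝ) (S : Matrix (Fin N) (Fin N) ℝ) (G : Matrix (Fin M) (Fin M) ℝ)
    (u : EuclideanSpace ℝ (Fin M)) : ℝ :=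
  (∫ ξ, ℓ (gaussPoint A S u ξ) ∂(stdGaussian (EuclideanSpace ℝ (Fin N)))) +
    1 / 2 * (u.ofLp ⬝ᵥ G⁻¹.mulVec u.ofLp)

/-- The measure on `ℝ^M` with Lebesgue density proportional to `exp (-V)`. -/
def gibbs {M : ℕ} (V : EuclideanSpace ℝ (Fin M) → ℝ) : Measure (EuclideanSpace ℝ (Fin M)) :=
  (∫⁻ u, ENNReal.ofReal (Real.exp (-V u)))⁻¹ •
    (volume : Measure (EuclideanSpace ℝ (Fin M))).withDensity
      fun u => ENNReal.ofReal (Real.exp (-V u))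

/-! ### Covariance matrices of the features and of the point evaluations -/

section Matrices

variable {X H : Type*} [NormedAddCommGroup H] [InnerProductSpace ℝ H] [CompleteSpace H]
  [RKHS ℝ H X ℝ] {N M : ℕ}

/-- `ℂ[F(x_{1:N}), F(x_{1:N})]` for `F ∼ P`. -/
def covFF [MeasurableSpace H] (P : Measure H) (x : Fin N → X) : Matrix (Fin N) (Fin N) ℝ :=
  Matrix.of fun n n' => cov[fun f : H => f (x n), fun f : H => f (x n'); P]

/-- `ℂ[F(x_{1:N}), U]` for `F ∼ P`. -/
def covFU [MeasurableSpace H] (P : Measure H) (x : Fin N → X) (h : Fin M → H) :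
    Matrix (Fin N) (Fin M) ℝ :=
  Matrix.of fun n m => cov[fun f : H => f (x n), fun f : H => ⟪f, h m⟫; P]

/-- `ℂ[U, U]` for `F ∼ P`. -/
def covUU [MeasurableSpace H] (P : Measure H) (h : Fin M → H) : Matrix (Fin M) (Fin M) ℝ :=
  Matrix.of fun m m' => cov[fun f : H => ⟪f, h m⟫, fun f : H => ⟪f, h m'⟫; P]

/-- The matrix of the map `u ↦ μ_u(x_{1:N}) = ℂ[F(x_{1:N}), U] ℂ[U, U]⁻¹ u`. -/
def meanMat [MeasurableSpace H] (P : Measure H) (x : Fin N → X) (h : Fin M → H) :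
    Matrix (Fin N) (Fin M) ℝ :=
  covFU P x h * (covUU P h)⁻¹

/-- `Σ(x_{1:N}) = ℂ[F, F] - ℂ[F, U] ℂ[U, U]⁻¹ ℂ[U, F]`. -/
def condCovMat [MeasurableSpace H] (P : Measure H) (x : Fin N → X) (h : Fin M → H) :
    Matrix (Fin N) (Fin N) ℝ :=
  covFF P x - covFU P x h * (covUU P h)⁻¹ * (covFU P x h).transpose

/-- The matrix `⟨C h, h⟩ = (⟨C h_m, h_{m'}⟩)_{m, m'}`. -/
def gramMat [MeasurableSpace X] (ν : Measure X) (h : Fin M → H) : Matrix (Fin M) (Fin M) ℝ :=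
  Matrix.of fun m m' => ⟪covOp ν (h m), h m'⟫

/-- The `M × N` matrix `e^{1:M}(x_{1:N}) = (e_m(x_n))_{m, n}`. -/
def eigMat (e : Fin M → H) (x : Fin N → X) : Matrix (Fin M) (Fin N) ℝ :=
  Matrix.of fun m n => e m (x n)

/-- `r(x_{1:N}, x_{1:N}) - e^{1:M}(x_{1:N})ᵀ Λ_M e^{1:M}(x_{1:N})`. -/
def eigCovMat [MeasurableSpace X] (ν : Measure X) (e : Fin M → H) (lam : Fin M → ℝ)
    (x : Fin N → X) : Matrix (Fin N) (Fin N) ℝ :=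
  Matrix.of (fun n n' => smoothedKer H ν (x n) (x n')) -
    (eigMat e x).transpose * Matrix.diagonal lam * eigMat e x

end Matrices

end

end GREApprox

/-! Write `P` for the prior, `P_U` for the law of the features under `P`, `L` for the loss on `H`,
`W u` for its mean under the conditional law given `U = u`, and let `τ*` be the posterior of prior
`P_U` and loss `W`. The heart of the proof is the identity `KL(Π_τ, Π_B) = const + KL(τ, τ*)`
whenever the left side is finite. In that case `Π_τ ≪ P`, and since the fibre condition makes `τ`
the image of `Π_τ` under `U`, also `τ ≪ P_U`. Then `dΠ_τ/dP` depends on `U` alone, so `log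
dΠ_τ/dΠ_B` is `L - W ∘ U + const + (log dτ/dτ*) ∘ U`, and the fluctuation `L - W ∘ U` averages to
zero on each fibre. Minimality and uniqueness follow from `KL(τ, τ*) = 0` iff `τ = τ*`
(`isKLArgmin_mixture`). Jensen on the fibres, `exp (-W u) ≤ E[exp (-L) | U = u]`, shows that `τ*`
exists and has a second moment. The bound `|t| ≤ t + 2 exp (-t)` makes the fluctuation integrable,
so the divergence at `τ*` is finite. It remains to identify `τ*`. The residual of the linear
regression of `F` on `U` is independent of `U`; this yields a conditional law for which `F(x_{1:N})`
is `N(μ_u, Σ)` for every `u`. As `P_U = N(0, G)`, with `G` the covariance matrix of `U`, has density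
proportional to `exp (-uᵀ G⁻¹ u / 2)`, `τ*` is the Gibbs measure of `V*`. Eigenfunctions are the
case where `G` is diagonal. -/

namespace GREApprox

/-! ### Tilted posteriors, Jensen's inequality, and densities of mixtures -/

section Variational

variable {H E : Type*} [MeasurableSpace H] [MeasurableSpace E]

/-- A Gibbs-type posterior with finite normalising constant is an exponentially tilted measure. -/
theorem posterior_eq_tilted {P : Measure H} [NeZero P] {L : H → ℝ}
    (hint : Integrable (fun f => Real.exp (-L f)) P) :
    posterior P L = P.tilted (fun f => -L f) := by
  have hpos : 0 < ∫ f, Real.exp (-L f) ∂P := integral_exp_pos hint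
  unfold posterior Measure.tilted
  rw [← ofReal_integral_eq_lintegral_ofReal hint (ae_of_all _ fun _ => (Real.exp_pos _).le),
    ← withDensity_smul' _ _ (by simpa using hpos)]
  congr 1
  ext f
  rw [Pi.smul_apply, smul_eq_mul, ENNReal.ofReal_div_of_pos hpos, mul_comm, div_eq_mul_inv]

/-- An infinite normalising constant has inverse `0`, which would turn `posterior` into the zero
measure. -/
theorem integrable_exp_of_posterior {P : Measure H} {L : H → ℝ} (hL : Measurable L)
    (h : IsProbabilityMeasure (posterior P L)) :
    Integrable (fun f => Real.exp (-L f)) P := by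
  refine ⟨(Real.measurable_exp.comp hL.neg).aestronglyMeasurable, ?_⟩
  rw [hasFiniteIntegral_iff_ofReal (ae_of_all _ fun _ => (Real.exp_pos _).le)]
  rw [lt_top_iff_ne_top]
  intro htop
  have h1 := h.measure_univ
  simp [posterior, htop] at h1

/-- Jensen's inequality for the exponential, in a form that needs no integrability of
`exp (-L)`. -/
theorem ofReal_exp_neg_integral_le {μ : Measure H} [IsProbabilityMeasure μ] {L : H → ℝ}
    (hL : Integrable L μ) :
    ENNReal.ofReal (Real.exp (-∫ f, L f ∂μ)) ≤ ∫⁻ f, ENNReal.ofReal (Real.exp (-L f)) ∂μ := by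
  by_cases hi : Integrable (fun f => Real.exp (-L f)) μ
  · rw [← ofReal_integral_eq_lintegral_ofReal hi (ae_of_all _ fun _ => (Real.exp_pos _).le),
      ← integral_neg]
    exact ENNReal.ofReal_le_ofReal (convexOn_exp.map_integral_le
      Real.continuous_exp.continuousOn isClosed_univ (by simp) hL.neg hi)
  · have : ∫⁻ f, ENNReal.ofReal (Real.exp (-L f)) ∂μ = ∞ := by
      by_contra hne
      refine hi ⟨Real.continuous_exp.comp_aestronglyMeasurable hL.neg.aestronglyMeasurable, ?_⟩
      rw [hasFiniteIntegral_iff_ofReal (ae_of_all _ fun _ => (Real.exp_pos _).le)]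
      exact lt_top_iff_ne_top.2 hne
    simp [this]

variable {P : Measure H} {U : H → E} {κ : Kernel E H}

theorem lintegral_posterior {L : H → ℝ} (hL : Measurable L) {φ : H → ℝ≥0∞} (hφ : Measurable φ) :
    ∫⁻ f, φ f ∂posterior P L = (∫⁻ f, ENNReal.ofReal (Real.exp (-L f)) ∂P)⁻¹ *
      ∫⁻ f, ENNReal.ofReal (Real.exp (-L f)) * φ f ∂P := by
  have hm : Measurable fun f => ENNReal.ofReal (Real.exp (-L f)) := by fun_prop
  rw [posterior, lintegral_smul_measure, lintegral_withDensity_eq_lintegral_mul _ hm hφ]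
  rfl

theorem IsCondLaw.ae_eq (hκ : IsCondLaw P U κ) (u : E) : ∀ᵐ f ∂κ u, U f = u := by
  rw [ae_iff]
  exact hκ.fibre u

/-- Each `κ u` lives on its own fibre, so it gives `U ⁻¹' A` mass one or zero according to whether
`u ∈ A`. This holds for every `u`, hence also for `τ` singular to the law of `U`. -/
theorem map_mixture (hU : Measurable U) (hκ : IsCondLaw P U κ) (τ : Measure E) :
    (mixture κ τ).map U = τ := by
  ext A hA
  rw [Measure.map_apply hU hA, mixture, Measure.bind_apply (hU hA) κ.aemeasurable]
  have := hκ.isMarkov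
  have h : ∀ u, κ u (U ⁻¹' A) = A.indicator 1 u := by
    intro u
    by_cases hu : u ∈ A
    · rw [Set.indicator_of_mem hu, Pi.one_apply, ← mem_ae_iff_prob_eq_one (hU hA)]
      filter_upwards [hκ.ae_eq u] with f hf
      simpa [hf] using hu
    · rw [Set.indicator_of_notMem hu]
      refine measure_mono_null (t := {f | U f ≠ u}) (fun f hf hfu => hu ?_) (hκ.fibre u)
      simpa [hfu] using hf
  simp_rw [h]
  rw [lintegral_indicator_one hA]

/-- Mixing a function of `(U, F)` over the conditional laws and then over the law of `U` gives the
prior expectation. -/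
theorem lintegral_cond [IsProbabilityMeasure P] (hU : Measurable U) (hκ : IsCondLaw P U κ)
    {φ : E × H → ℝ≥0∞} (hφ : Measurable φ) :
    ∫⁻ u, ∫⁻ f, φ (u, f) ∂κ u ∂P.map U = ∫⁻ f, φ (U f, f) ∂P := by
  have := hκ.isMarkov
  have := Measure.isProbabilityMeasure_map (μ := P) hU.aemeasurable
  rw [← Measure.lintegral_compProd hφ, ← hκ.disintegration,
    lintegral_map hφ (hU.prodMk measurable_id')]

/-- The density of `τ` with respect to the law of `U` is constant on fibres, so it passes through
the disintegration of `P`. -/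
theorem mixture_eq_withDensity [IsProbabilityMeasure P] (hU : Measurable U)
    (hκ : IsCondLaw P U κ) {τ : Measure E} [SigmaFinite τ] (hτ : τ ≪ P.map U) :
    mixture κ τ = P.withDensity fun f => τ.rnDeriv (P.map U) (U f) := by
  have := hκ.isMarkov
  have := Measure.isProbabilityMeasure_map (μ := P) hU.aemeasurable
  ext B hB
  have hg := Measure.measurable_rnDeriv τ (P.map U)
  rw [mixture, Measure.bind_apply hB κ.aemeasurable, withDensity_apply _ hB,
    ← lintegral_indicator hB]
  have key := lintegral_cond (P := P) hU hκ
    (φ := fun p => B.indicator (fun _ => τ.rnDeriv (P.map U) p.1) p.2)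
    ((hg.comp measurable_fst).indicator (measurable_snd hB))
  conv_lhs => rw [← Measure.withDensity_rnDeriv_eq τ (P.map U) hτ]
  rw [lintegral_withDensity_eq_lintegral_mul _ hg (κ.measurable_coe hB)]
  calc _ = _ := ?_
    _ = _ := key
    _ = _ := rfl
  refine lintegral_congr fun u => ?_
  exact (lintegral_indicator_const hB _).symm

theorem llr_mixture [IsProbabilityMeasure P] (hU : Measurable U)
    (hκ : IsCondLaw P U κ) {τ : Measure E} [SigmaFinite τ] (hτ : τ ≪ P.map U) :
    llr (mixture κ τ) P =ᵐ[mixture κ τ] fun f => llr τ (P.map U) (U f) := by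
  have hg := Measure.measurable_rnDeriv τ (P.map U)
  have h := mixture_eq_withDensity hU hκ hτ
  have hac : mixture κ τ ≪ P := by rw [h]; exact withDensity_absolutelyContinuous _ _
  refine hac.ae_le ?_
  filter_upwards [Measure.rnDeriv_withDensity P (hg.comp hU)] with f hf
  simp only [llr, h]
  rw [show (P.withDensity fun f => τ.rnDeriv (P.map U) (U f)) =
    P.withDensity ((τ.rnDeriv (P.map U)) ∘ U) from rfl, hf]
  rfl

end Variational

/-! ### The divergence identity and the abstract minimiser -/

section Argmin

variable {H E : Type*} [MeasurableSpace H] [MeasurableSpace E]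
  {P : Measure H} [IsProbabilityMeasure P] {U : H → E} {κ : Kernel E H} {L : H → ℝ} {W : E → ℝ}

/-- Averaging the loss over the fibres of `U` can only decrease weighted normalising constants. -/
theorem lintegral_exp_neg_condLoss_le (hU : Measurable U) (hκ : IsCondLaw P U κ)
    (hL : Measurable L) (hLint : ∀ᵐ u ∂P.map U, Integrable L (κ u))
    (hW : ∀ᵐ u ∂P.map U, ∫ f, L f ∂κ u = W u) {φ : E → ℝ≥0∞} (hφ : Measurable φ) :
    ∫⁻ u, ENNReal.ofReal (Real.exp (-W u)) * φ u ∂P.map U ≤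
      ∫⁻ f, ENNReal.ofReal (Real.exp (-L f)) * φ (U f) ∂P := by
  have := hκ.isMarkov
  have hm : Measurable fun f => ENNReal.ofReal (Real.exp (-L f)) := by fun_prop
  rw [← lintegral_cond hU hκ (φ := fun p => ENNReal.ofReal (Real.exp (-L p.2)) * φ p.1)
    (by fun_prop)]
  refine lintegral_mono_ae ?_
  filter_upwards [hLint, hW] with u h1 h2
  -- The weight is constant on the fibre and factors out, leaving Jensen's inequality for `κ u`.
  rw [lintegral_mul_const _ hm, ← h2]
  gcongr
  exact ofReal_exp_neg_integral_le h1

theorem integrable_exp_neg_condLoss (hU : Measurable U) (hκ : IsCondLaw P U κ)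
    (hL : Measurable L) (hWm : Measurable W) (hLint : ∀ᵐ u ∂P.map U, Integrable L (κ u))
    (hW : ∀ᵐ u ∂P.map U, ∫ f, L f ∂κ u = W u)
    (hint : Integrable (fun f => Real.exp (-L f)) P) :
    Integrable (fun u => Real.exp (-W u)) (P.map U) := by
  refine ⟨(Real.measurable_exp.comp hWm.neg).aestronglyMeasurable, ?_⟩
  rw [hasFiniteIntegral_iff_ofReal (ae_of_all _ fun _ => (Real.exp_pos _).le)]
  have h := lintegral_exp_neg_condLoss_le hU hκ hL hLint hW (φ := fun _ => 1) measurable_const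
  simp only [mul_one] at h
  refine h.trans_lt ?_
  rw [← hasFiniteIntegral_iff_ofReal (ae_of_all _ fun _ => (Real.exp_pos _).le)]
  exact hint.2

theorem mixture_isProbabilityMeasure [IsMarkovKernel κ] (τ : Measure E)
    [IsProbabilityMeasure τ] : IsProbabilityMeasure (mixture κ τ) := by
  unfold mixture; infer_instance

theorem mixture_ac (hU : Measurable U) (hκ : IsCondLaw P U κ) {τ : Measure E} [SigmaFinite τ]
    (hτ : τ ≪ P.map U) : mixture κ τ ≪ P := by
  rw [mixture_eq_withDensity hU hκ hτ]
  exact withDensity_absolutelyContinuous _ _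

/-- Difference of the normalising constants of the two posteriors on the logarithmic scale. -/
noncomputable def logNormDiff (P : Measure H) (U : H → E) (L : H → ℝ) (W : E → ℝ) : ℝ :=
  Real.log (∫ f, Real.exp (-L f) ∂P) - Real.log (∫ u, Real.exp (-W u) ∂P.map U)

/-- Tilting the reference measure changes a log-likelihood ratio by the loss plus the log
normaliser. This is done on `H` and on `E`, where the untilted ratios coincide by `llr_mixture`; no
relation between `L` and `W` enters yet. -/
theorem llr_mixture_posterior (hU : Measurable U) (hκ : IsCondLaw P U κ)
    (hLi : Integrable (fun f => Real.exp (-L f)) P)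
    (hWi : Integrable (fun u => Real.exp (-W u)) (P.map U))
    {τ : Measure E} [IsProbabilityMeasure τ] (hτ : τ ≪ P.map U) :
    llr (mixture κ τ) (posterior P L) =ᵐ[mixture κ τ] fun f =>
      L f - W (U f) + logNormDiff P U L W + llr τ (posterior (P.map U) W) (U f) := by
  have := hκ.isMarkov
  have := Measure.isProbabilityMeasure_map (μ := P) hU.aemeasurable
  have := mixture_isProbabilityMeasure (κ := κ) τ
  rw [posterior_eq_tilted hLi, posterior_eq_tilted hWi]
  have h1 := llr_tilted_right (mixture_ac hU hκ hτ) hLi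
  have h2 := llr_tilted_right hτ hWi
  -- Viewing `τ` as the image of the mixture turns a statement for `τ`-almost every `u` into one
  -- about `U f`.
  rw [← map_mixture hU hκ τ] at h2
  have h3 := ae_of_ae_map hU.aemeasurable h2
  rw [map_mixture hU hκ τ] at h3
  filter_upwards [h1, h3, llr_mixture hU hκ hτ] with f e1 e2 e3
  rw [e1, e2, e3, logNormDiff]
  ring

theorem integral_mixture {τ : Measure E} [IsProbabilityMeasure τ] [IsMarkovKernel κ] {F : H → ℝ}
    (hF : Integrable F (mixture κ τ)) :
    Integrable (fun u => ∫ f, F f ∂κ u) τ ∧ ∫ f, F f ∂mixture κ τ = ∫ u, ∫ f, F f ∂κ u ∂τ := by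
  have h : Integrable F ((κ ∘ₖ Kernel.const Unit τ) ()) := by
    rwa [← Measure.comp_eq_comp_const_apply]
  refine ⟨by simpa using h.integral_comp, ?_⟩
  rw [mixture, Measure.comp_eq_comp_const_apply, Kernel.integral_comp h]
  simp

/-- The divergence to the posterior on `H` and the divergence of the mixing measures differ by a
constant. -/
theorem integral_llr_mixture_posterior (hU : Measurable U) (hκ : IsCondLaw P U κ)
    (hLint : ∀ᵐ u ∂P.map U, Integrable L (κ u))
    (hW : ∀ᵐ u ∂P.map U, ∫ f, L f ∂κ u = W u)
    (hLi : Integrable (fun f => Real.exp (-L f)) P)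
    (hWi : Integrable (fun u => Real.exp (-W u)) (P.map U))
    {τ : Measure E} [IsProbabilityMeasure τ] (hτ : τ ≪ P.map U)
    (hi : Integrable (llr (mixture κ τ) (posterior P L)) (mixture κ τ)) :
    Integrable (llr τ (posterior (P.map U) W)) τ ∧
      ∫ f, llr (mixture κ τ) (posterior P L) f ∂mixture κ τ =
        logNormDiff P U L W + ∫ u, llr τ (posterior (P.map U) W) u ∂τ := by
  have := hκ.isMarkov
  have hllr := llr_mixture_posterior hU hκ hLi hWi hτ
  have hi' := (integrable_congr hllr).1 hi
  obtain ⟨h1, h2⟩ := integral_mixture hi'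
  -- On the fibre over `u` everything but `L` is constant, and `L` averages to `W u`. Keeping the
  -- difference together avoids requiring `L` or `W ∘ U` to be integrable under the mixture.
  have h3 : ∀ᵐ u ∂τ, ∫ f, (L f - W (U f) + logNormDiff P U L W +
      llr τ (posterior (P.map U) W) (U f)) ∂κ u =
      logNormDiff P U L W + llr τ (posterior (P.map U) W) u := by
    filter_upwards [hτ.ae_le hLint, hτ.ae_le hW] with u i1 i2
    have e : (fun f => L f - W (U f) + logNormDiff P U L W +
      llr τ (posterior (P.map U) W) (U f)) =ᵐ[κ u] fun f => L f + (- W u + logNormDiff P U L W +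
      llr τ (posterior (P.map U) W) u) := by
      filter_upwards [hκ.ae_eq u] with f hf
      rw [hf]; ring
    rw [integral_congr_ae e, integral_add i1 (integrable_const _), i2]
    simp
    ring
  have h4 := (integrable_congr h3).1 h1
  have h5 : Integrable (llr τ (posterior (P.map U) W)) τ := by
    refine (h4.sub (integrable_const (logNormDiff P U L W))).congr (ae_of_all _ fun u => ?_)
    simp
  refine ⟨h5, ?_⟩
  rw [integral_congr_ae hllr, h2, integral_congr_ae h3, integral_add (integrable_const _) h5]
  simp

/-- Used with `x = L f - W u`: the linear term has mean zero on the fibre, and the exponential is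
controlled by the normalising constant of the posterior. -/
theorem abs_le_self_add_two_mul_exp_neg (x : ℝ) : |x| ≤ x + 2 * Real.exp (-x) := by
  rcases le_total 0 x with h | h
  · rw [abs_of_nonneg h]; linarith [Real.exp_pos (-x)]
  · rw [abs_of_nonpos h]; linarith [Real.add_one_le_exp (-x)]

/-- Under the optimal mixture, the fluctuation of the loss around its conditional mean is
integrable. -/
theorem integrable_loss_sub_condLoss (hU : Measurable U) (hκ : IsCondLaw P U κ)
    (hL : Measurable L) (hWm : Measurable W) (hLint : ∀ᵐ u ∂P.map U, Integrable L (κ u))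
    (hW : ∀ᵐ u ∂P.map U, ∫ f, L f ∂κ u = W u)
    (hLi : Integrable (fun f => Real.exp (-L f)) P)
    (hWi : Integrable (fun u => Real.exp (-W u)) (P.map U)) :
    Integrable (fun f => L f - W (U f)) (mixture κ (posterior (P.map U) W)) := by
  have := hκ.isMarkov
  have := Measure.isProbabilityMeasure_map (μ := P) hU.aemeasurable
  have hm : Measurable fun u => ENNReal.ofReal (Real.exp (-W u)) := by fun_prop
  have hm' : Measurable fun u => ENNReal.ofReal (Real.exp (-L u)) := by fun_prop
  have hF : Measurable fun f => L f - W (U f) := by fun_prop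
  refine ⟨hF.aestronglyMeasurable, ?_⟩
  unfold HasFiniteIntegral mixture
  rw [Measure.lintegral_bind κ.aemeasurable hF.enorm.aemeasurable]
  have hφ : Measurable fun u => ∫⁻ f, ‖L f - W (U f)‖ₑ ∂κ u := hF.enorm.lintegral_kernel
  rw [lintegral_posterior hWm hφ]
  -- The weight `exp (-W u)` cancels the factor `exp (W u)` produced by `exp (-(L f - W u))`. If
  -- `exp (-L)` is not integrable on the fibre, the right side is infinite.
  have hbound : ∀ᵐ u ∂P.map U, ENNReal.ofReal (Real.exp (-W u)) *
      ∫⁻ f, ‖L f - W (U f)‖ₑ ∂κ u ≤ 2 * ∫⁻ f, ENNReal.ofReal (Real.exp (-L f)) ∂κ u := by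
    filter_upwards [hLint, hW] with u i1 i2
    by_cases hi : Integrable (fun f => Real.exp (-L f)) (κ u)
    · have i3 : Integrable (fun f => L f - W u) (κ u) := i1.sub (integrable_const _)
      have e : ∫⁻ f, ‖L f - W (U f)‖ₑ ∂κ u = ENNReal.ofReal (∫ f, |L f - W u| ∂κ u) := by
        rw [ofReal_integral_eq_lintegral_ofReal i3.abs (ae_of_all _ fun _ => abs_nonneg _)]
        refine lintegral_congr_ae ?_
        filter_upwards [hκ.ae_eq u] with f hf
        rw [hf, Real.enorm_eq_ofReal_abs]
      have i4 : Integrable (fun f => Real.exp (-(L f - W u))) (κ u) := by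
        have := hi.mul_const (Real.exp (W u))
        refine this.congr (ae_of_all _ fun f => ?_)
        simp only
        rw [← Real.exp_add]; congr 1; ring
      have b : ∫ f, |L f - W u| ∂κ u ≤ 2 * (Real.exp (W u) * ∫ f, Real.exp (-L f) ∂κ u) := by
        calc ∫ f, |L f - W u| ∂κ u
            ≤ ∫ f, ((L f - W u) + 2 * Real.exp (-(L f - W u))) ∂κ u :=
              integral_mono i3.abs (i3.add (i4.const_mul 2)) fun f =>
                abs_le_self_add_two_mul_exp_neg _
          _ = _ := by
            have e2 : ∫ f, Real.exp (-(L f - W u)) ∂κ u =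
                Real.exp (W u) * ∫ f, Real.exp (-L f) ∂κ u := by
              rw [← integral_const_mul]
              refine integral_congr_ae (ae_of_all _ fun f => ?_)
              simp only
              rw [← Real.exp_add]; congr 1; ring
            rw [integral_add i3 (i4.const_mul 2), integral_sub i1 (integrable_const _), i2,
              integral_const_mul, e2]
            simp
      rw [e, ← ENNReal.ofReal_mul (Real.exp_pos _).le,
        ← ofReal_integral_eq_lintegral_ofReal hi (ae_of_all _ fun _ => (Real.exp_pos _).le),
        show (2 : ℝ≥0∞) = ENNReal.ofReal 2 by simp, ← ENNReal.ofReal_mul zero_le_two]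
      refine ENNReal.ofReal_le_ofReal ?_
      calc Real.exp (-W u) * ∫ f, |L f - W u| ∂κ u
          ≤ Real.exp (-W u) * (2 * (Real.exp (W u) * ∫ f, Real.exp (-L f) ∂κ u)) := by gcongr
        _ = (Real.exp (-W u) * Real.exp (W u)) * (2 * ∫ f, Real.exp (-L f) ∂κ u) := by ring
        _ = _ := by rw [← Real.exp_add]; simp
    · have : ∫⁻ f, ENNReal.ofReal (Real.exp (-L f)) ∂κ u = ∞ := by
        by_contra hne
        refine hi ⟨(Real.measurable_exp.comp hL.neg).aestronglyMeasurable, ?_⟩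
        rw [hasFiniteIntegral_iff_ofReal (ae_of_all _ fun _ => (Real.exp_pos _).le)]
        exact lt_top_iff_ne_top.2 hne
      simp [this]
  refine ENNReal.mul_lt_top ?_ ((lintegral_mono_ae hbound).trans_lt ?_)
  · rw [← ofReal_integral_eq_lintegral_ofReal hWi (ae_of_all _ fun _ => (Real.exp_pos _).le)]
    simpa using integral_exp_pos hWi
  · rw [lintegral_const_mul _ hm'.lintegral_kernel,
      lintegral_cond hU hκ (φ := fun p => ENNReal.ofReal (Real.exp (-L p.2))) (by fun_prop)]
    exact ENNReal.mul_lt_top (by simp)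
      ((hasFiniteIntegral_iff_ofReal (ae_of_all _ fun _ => (Real.exp_pos _).le)).1 hLi.2)

end Argmin

/-- The optimal mixing measure is the posterior of the averaged loss. -/
theorem isKLArgmin_mixture {H E : Type*} [NormedAddCommGroup H] [MeasurableSpace H]
    [OpensMeasurableSpace H] [NormedAddCommGroup E] [MeasurableSpace E] [OpensMeasurableSpace E]
    {P : Measure H} [IsProbabilityMeasure P] {U : H → E} {κ : Kernel E H} {L : H → ℝ} {W : E → ℝ}
    (hU : Measurable U) {C : NNReal} (hC : ∀ f, ‖U f‖ₑ ≤ C * ‖f‖ₑ) (hκ : IsCondLaw P U κ)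
    (hL : Measurable L) (hWm : Measurable W) (hLint : ∀ᵐ u ∂P.map U, Integrable L (κ u))
    (hW : ∀ᵐ u ∂P.map U, ∫ f, L f ∂κ u = W u) (hR : IsP2 (posterior P L)) :
    IsP2 (posterior (P.map U) W) ∧
      IsKLArgmin (family κ) (posterior P L) (mixture κ (posterior (P.map U) W)) := by
  have := hκ.isMarkov
  have := hR.1
  have := Measure.isProbabilityMeasure_map (μ := P) hU.aemeasurable
  have hLi := integrable_exp_of_posterior hL hR.1
  have hWi := integrable_exp_neg_condLoss hU hκ hL hWm hLint hW hLi
  have hpW : IsProbabilityMeasure (posterior (P.map U) W) := by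
    rw [posterior_eq_tilted hWi]
    exact isProbabilityMeasure_tilted hWi
  have hZ : (∫⁻ f, ENNReal.ofReal (Real.exp (-L f)) ∂P)⁻¹ ≠ 0 := by
    rw [← ofReal_integral_eq_lintegral_ofReal hLi (ae_of_all _ fun _ => (Real.exp_pos _).le)]
    simp
  have hP2 : IsP2 (posterior (P.map U) W) := by
    refine ⟨hpW, ?_⟩
    rw [lintegral_posterior hWm (by fun_prop)]
    -- Fibrewise Jensen with weight `‖u‖²` bounds the second moment by that of `U` under the
    -- posterior on `H`, and `U` grows at most linearly.
    refine ENNReal.mul_lt_top ?_ ((lintegral_exp_neg_condLoss_le hU hκ hL hLint hW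
      (φ := fun u => ‖u‖ₑ ^ 2) (by fun_prop)).trans_lt ?_)
    · rw [← ofReal_integral_eq_lintegral_ofReal hWi (ae_of_all _ fun _ => (Real.exp_pos _).le)]
      simpa using integral_exp_pos hWi
    · have h2 := hR.2
      rw [lintegral_posterior hL (by fun_prop)] at h2
      have h3 : ∫⁻ f, ENNReal.ofReal (Real.exp (-L f)) * ‖f‖ₑ ^ 2 ∂P ≠ ∞ := by
        intro h
        rw [h, ENNReal.mul_top hZ] at h2
        exact lt_irrefl _ h2
      calc ∫⁻ f, ENNReal.ofReal (Real.exp (-L f)) * ‖U f‖ₑ ^ 2 ∂P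
          ≤ ∫⁻ f, (C : ℝ≥0∞) ^ 2 * (ENNReal.ofReal (Real.exp (-L f)) * ‖f‖ₑ ^ 2) ∂P := by
            refine lintegral_mono fun f => ?_
            calc _ ≤ ENNReal.ofReal (Real.exp (-L f)) * (C * ‖f‖ₑ) ^ 2 := by
                  gcongr; exact hC f
              _ = _ := by ring
        _ = (C : ℝ≥0∞) ^ 2 * ∫⁻ f, ENNReal.ofReal (Real.exp (-L f)) * ‖f‖ₑ ^ 2 ∂P := by
            rw [lintegral_const_mul]; fun_prop
        _ < ∞ := ENNReal.mul_lt_top (by simp) (lt_top_iff_ne_top.2 h3)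
  refine ⟨hP2, ⟨_, hP2, rfl⟩, ?_⟩
  have hacW : posterior (P.map U) W ≪ P.map U := by
    rw [posterior_eq_tilted hWi]; exact tilted_absolutelyContinuous _ _
  have hPR : P ≪ posterior P L := by
    rw [posterior_eq_tilted hLi]; exact absolutelyContinuous_tilted hLi
  have hRP : posterior P L ≪ P := by
    rw [posterior_eq_tilted hLi]; exact tilted_absolutelyContinuous _ _
  have := mixture_isProbabilityMeasure (κ := κ) (posterior (P.map U) W)
  -- At the optimum the ratio of the mixing measures is trivial, leaving the fluctuation of the loss
  -- and a constant.
  have hi0 : Integrable (llr (mixture κ (posterior (P.map U) W)) (posterior P L))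
      (mixture κ (posterior (P.map U) W)) := by
    refine (integrable_congr (llr_mixture_posterior hU hκ hLi hWi hacW)).2 ?_
    have h0 := llr_self (posterior (P.map U) W)
    rw [← map_mixture hU hκ (posterior (P.map U) W)] at h0
    have h0' := ae_of_ae_map hU.aemeasurable h0
    rw [map_mixture hU hκ (posterior (P.map U) W)] at h0'
    refine ((integrable_loss_sub_condLoss hU hκ hL hWm hLint hW hLi hWi).add
      (integrable_const (logNormDiff P U L W))).congr ?_
    filter_upwards [h0'] with f hf
    simp [hf]
  have hac0 : mixture κ (posterior (P.map U) W) ≪ posterior P L := (mixture_ac hU hκ hacW).trans hPR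
  rintro Q ⟨τ, hτ, rfl⟩ hne
  have := hτ.1
  have := mixture_isProbabilityMeasure (κ := κ) τ
  by_cases htop : klDiv (mixture κ τ) (posterior P L) = ∞
  · rw [htop, lt_top_iff_ne_top]
    exact klDiv_ne_top hac0 hi0
  obtain ⟨hac, hi⟩ := klDiv_ne_top_iff.1 htop
  have hτU : τ ≪ P.map U := by
    rw [← map_mixture hU hκ τ]
    exact (hac.trans hRP).map hU
  obtain ⟨hiτ, heq⟩ := integral_llr_mixture_posterior hU hκ hLint hW hLi hWi hτU hi
  obtain ⟨_, heq0⟩ := integral_llr_mixture_posterior hU hκ hLint hW hLi hWi hacW hi0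
  rw [integral_congr_ae (llr_self _)] at heq0
  have hτW : τ ≪ posterior (P.map U) W := by
    refine hτU.trans ?_
    rw [posterior_eq_tilted hWi]; exact absolutelyContinuous_tilted hWi
  -- This integral is the gap between the two divergences; it vanishes only if the mixing measures,
  -- hence the mixtures, agree.
  have hpos : 0 < ∫ u, llr τ (posterior (P.map U) W) u ∂τ := by
    rw [← toReal_klDiv_of_measure_eq hτW (by simp)]
    refine ENNReal.toReal_pos ?_ (klDiv_ne_top hτW hiτ)
    rw [Ne, klDiv_eq_zero_iff]
    rintro rfl
    exact hne rfl
  rw [← ENNReal.toReal_lt_toReal (klDiv_ne_top hac0 hi0) htop,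
    toReal_klDiv_of_measure_eq hac0 (by simp), toReal_klDiv_of_measure_eq hac (by simp), heq, heq0]
  simpa using hpos

/-! ### Lebesgue densities of Gaussian measures and the Gibbs form -/

section GaussianDensity

theorem map_withDensity_comp {α β : Type*} [MeasurableSpace α] [MeasurableSpace β]
    (μ : Measure α) {T : α → β} (hT : Measurable T) {h : β → ℝ≥0∞} (hh : Measurable h) :
    (μ.withDensity (h ∘ T)).map T = (μ.map T).withDensity h := by
  ext s hs
  rw [Measure.map_apply hT hs, withDensity_apply _ (hT hs), withDensity_apply _ hs,
    setLIntegral_map hs hh hT]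
  rfl

/-- The standard Gaussian measure has a Lebesgue density proportional to `exp (-‖v‖² / 2)`. -/
theorem exists_stdGaussian_eq_smul (E : Type*) [NormedAddCommGroup E] [InnerProductSpace ℝ E]
    [FiniteDimensional ℝ E] [MeasurableSpace E] [BorelSpace E] :
    ∃ c : ℝ≥0∞, c ≠ 0 ∧ c ≠ ∞ ∧ stdGaussian E =
      c • (volume : Measure E).withDensity fun v => ENNReal.ofReal (Real.exp (-(‖v‖ ^ 2 / 2))) := by
  have hb : (0 : ℝ) < ((1 / 2 : ℂ)).re := by norm_num
  have hI : Integrable (fun v : E => Real.exp (-(‖v‖ ^ 2 / 2))) := by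
    have h := (GaussianFourier.integrable_cexp_neg_mul_sq_norm_add hb 0 (0 : E)).re
    refine h.congr (ae_of_all _ fun v => ?_)
    have : (-(1 / 2 : ℂ) * ‖v‖ ^ 2 + 0 * (⟪(0 : E), v⟫ : ℝ)) = ((-(‖v‖ ^ 2 / 2) : ℝ) : ℂ) := by
      push_cast; ring
    simp only [this]
    rw [← Complex.ofReal_exp]
    rfl
  have hpos := integral_exp_pos hI
  set m := ∫ v : E, Real.exp (-(‖v‖ ^ 2 / 2)) with hm
  refine ⟨(ENNReal.ofReal m)⁻¹, by simp, by simpa using hpos, ?_⟩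
  have hden : Measurable fun v : E => ENNReal.ofReal (Real.exp (-(‖v‖ ^ 2 / 2))) := by fun_prop
  have hprob : IsProbabilityMeasure ((ENNReal.ofReal m)⁻¹ • (volume : Measure E).withDensity
      fun v => ENNReal.ofReal (Real.exp (-(‖v‖ ^ 2 / 2)))) := by
    refine ⟨?_⟩
    rw [Measure.smul_apply, withDensity_apply _ MeasurableSet.univ, Measure.restrict_univ,
      ← ofReal_integral_eq_lintegral_ofReal hI (ae_of_all _ fun _ => (Real.exp_pos _).le), ← hm,
      smul_eq_mul, ENNReal.inv_mul_cancel (by simpa using hpos) (by simp)]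
  refine Measure.ext_of_charFun ?_
  ext t
  -- The Fourier transform of the unnormalised Gaussian; its value at `w = 0` is the normalising
  -- constant `m`.
  have hF : ∀ w : E, ∫ v : E, ((Real.exp (-(‖v‖ ^ 2 / 2)) : ℝ) : ℂ) *
      Complex.exp ((⟪v, w⟫ : ℝ) * Complex.I) =
      (Real.pi / (1 / 2 : ℂ)) ^ (Module.finrank ℝ E / 2 : ℂ) *
        Complex.exp (-‖w‖ ^ 2 / 2) := by
    intro w
    have := GaussianFourier.integral_cexp_neg_mul_sq_norm_add hb Complex.I w
    rw [show Complex.I ^ 2 * (‖w‖ : ℂ) ^ 2 / (4 * (1 / 2)) = -‖w‖ ^ 2 / 2 by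
      rw [Complex.I_sq]; ring] at this
    rw [← this]
    refine integral_congr_ae (ae_of_all _ fun v => ?_)
    simp only
    rw [Complex.ofReal_exp, ← Complex.exp_add, real_inner_comm]
    congr 1
    push_cast
    ring
  have hm' : (m : ℂ) = (Real.pi / (1 / 2 : ℂ)) ^ (Module.finrank ℝ E / 2 : ℂ) := by
    have := hF 0
    simp only [inner_zero_right, Complex.ofReal_zero, zero_mul, Complex.exp_zero, mul_one,
      norm_zero] at this
    rw [hm, ← integral_complex_ofReal, this]
    simp
  rw [charFun_stdGaussian, charFun_apply, integral_smul_measure,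
    integral_withDensity_eq_integral_toReal_smul hden (by simp)]
  have : ∀ v : E, (ENNReal.ofReal (Real.exp (-(‖v‖ ^ 2 / 2)))).toReal •
      Complex.exp ((⟪v, t⟫ : ℝ) * Complex.I) = ((Real.exp (-(‖v‖ ^ 2 / 2)) : ℝ) : ℂ) *
      Complex.exp ((⟪v, t⟫ : ℝ) * Complex.I) := by
    intro v
    rw [ENNReal.toReal_ofReal (Real.exp_pos _).le, Complex.real_smul]
  simp_rw [this]
  rw [hF t, ← hm', ENNReal.toReal_inv, ENNReal.toReal_ofReal hpos.le, Complex.real_smul,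
    ← mul_assoc, Complex.ofReal_inv, inv_mul_cancel₀ (by exact_mod_cast hpos.ne'), one_mul]

/-- A centred Gaussian measure with positive definite covariance matrix `G` has a Lebesgue density
proportional to `exp (-uᵀ G⁻¹ u / 2)`. -/
theorem exists_multivariateGaussian_eq_smul {M : ℕ} {G : Matrix (Fin M) (Fin M) ℝ}
    (hG : G.PosDef) :
    ∃ c : ℝ≥0∞, c ≠ 0 ∧ c ≠ ∞ ∧ multivariateGaussian 0 G =
      c • (volume : Measure (EuclideanSpace ℝ (Fin M))).withDensity fun u =>
        ENNReal.ofReal (Real.exp (-(1 / 2 * (u.ofLp ⬝ᵥ G⁻¹.mulVec u.ofLp)))) := by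
  obtain ⟨c, hc0, hct, hc⟩ := exists_stdGaussian_eq_smul (EuclideanSpace ℝ (Fin M))
  set S := CFC.sqrt G with hS
  have hSS : S * S = G := CFC.sqrt_mul_sqrt_self G hG.posSemidef.nonneg
  have hSdet : S.det ≠ 0 := by
    intro h
    have := hG.det_pos
    rw [← hSS, Matrix.det_mul, h, mul_zero] at this
    exact lt_irrefl _ this
  have hSsym : S.transpose = S := by
    have := (CFC.sqrt_nonneg G).isSelfAdjoint
    simpa [IsSelfAdjoint, Matrix.star_eq_conjTranspose] using this
  have hSu : IsUnit S.det := isUnit_iff_ne_zero.2 hSdet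
  set T : EuclideanSpace ℝ (Fin M) →L[ℝ] EuclideanSpace ℝ (Fin M) :=
    Matrix.toEuclideanCLM (𝕜 := ℝ) S with hT
  have hTv : ∀ v, (T v).ofLp = S.mulVec v.ofLp := fun v => by
    rw [hT, Matrix.ofLp_toEuclideanCLM]
  -- With `S` symmetric and `S * S = G`, the product `S G⁻¹ S` is the identity.
  have hquad : ∀ v, (T v).ofLp ⬝ᵥ G⁻¹.mulVec (T v).ofLp = ‖v‖ ^ 2 := by
    intro v
    rw [hTv, Matrix.mulVec_mulVec, ← hSS, Matrix.mul_inv_rev, Matrix.mul_assoc,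
      Matrix.nonsing_inv_mul _ hSu, Matrix.mul_one, Matrix.dotProduct_mulVec,
      ← Matrix.mulVec_transpose, Matrix.mulVec_mulVec, Matrix.transpose_nonsing_inv, hSsym,
      Matrix.nonsing_inv_mul _ hSu, Matrix.one_mulVec, EuclideanSpace.real_norm_sq_eq]
    simp [dotProduct, sq]
  have hdet : LinearMap.det (T : EuclideanSpace ℝ (Fin M) →ₗ[ℝ] EuclideanSpace ℝ (Fin M)) ≠ 0 := by
    intro h
    have hinj : Function.Injective T := by
      intro v w hvw
      have : S.mulVec v.ofLp = S.mulVec w.ofLp := by rw [← hTv, ← hTv, hvw]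
      exact WithLp.ofLp_injective 2 (Matrix.mulVec_injective_of_isUnit
        ((Matrix.isUnit_iff_isUnit_det S).2 hSu) this)
    have := LinearMap.bot_lt_ker_of_det_eq_zero h
    rw [LinearMap.ker_eq_bot.2 hinj] at this
    exact lt_irrefl _ this
  have hh : Measurable fun u : EuclideanSpace ℝ (Fin M) =>
      ENNReal.ofReal (Real.exp (-(1 / 2 * (u.ofLp ⬝ᵥ G⁻¹.mulVec u.ofLp)))) := by
    have : Continuous fun u : EuclideanSpace ℝ (Fin M) => u.ofLp ⬝ᵥ G⁻¹.mulVec u.ofLp := by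
      fun_prop
    fun_prop
  refine ⟨c * ENNReal.ofReal |(LinearMap.det
    (T : EuclideanSpace ℝ (Fin M) →ₗ[ℝ] EuclideanSpace ℝ (Fin M)))⁻¹|,
    mul_ne_zero hc0 (by simpa using hdet), ENNReal.mul_ne_top hct ENNReal.ofReal_ne_top, ?_⟩
  have hmap : (volume : Measure (EuclideanSpace ℝ (Fin M))).map T = _ :=
    Measure.map_linearMap_addHaar_eq_smul_addHaar volume hdet
  have e : multivariateGaussian 0 G = (stdGaussian (EuclideanSpace ℝ (Fin M))).map T := by
    simp [multivariateGaussian, hT, hS]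
  have e2 : (fun v : EuclideanSpace ℝ (Fin M) => ENNReal.ofReal (Real.exp (-(‖v‖ ^ 2 / 2)))) =
      (fun u : EuclideanSpace ℝ (Fin M) =>
        ENNReal.ofReal (Real.exp (-(1 / 2 * (u.ofLp ⬝ᵥ G⁻¹.mulVec u.ofLp))))) ∘ T := by
    ext v
    simp only [Function.comp, hquad]
    congr 3
    ring
  rw [e, hc, e2, Measure.map_smul, map_withDensity_comp _ T.measurable hh, hmap,
    withDensity_smul_measure, smul_smul]

/-- The constant `c` occurs in the prior and in the normaliser and cancels, being neither `0` nor
`∞`. -/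
theorem posterior_eq_gibbs {M : ℕ} {μ : Measure (EuclideanSpace ℝ (Fin M))}
    {W q : EuclideanSpace ℝ (Fin M) → ℝ} (hW : Measurable W) (hq : Measurable q) {c : ℝ≥0∞}
    (hc0 : c ≠ 0) (hct : c ≠ ∞)
    (hμ : μ = c • (volume : Measure (EuclideanSpace ℝ (Fin M))).withDensity fun u =>
      ENNReal.ofReal (Real.exp (-q u))) :
    posterior μ W = gibbs fun u => W u + q u := by
  have hWm : Measurable fun u => ENNReal.ofReal (Real.exp (-W u)) := by fun_prop
  have hqm : Measurable fun u => ENNReal.ofReal (Real.exp (-q u)) := by fun_prop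
  have hmul : (fun u => ENNReal.ofReal (Real.exp (-(W u + q u)))) =
      (fun u => ENNReal.ofReal (Real.exp (-q u))) * fun u => ENNReal.ofReal (Real.exp (-W u)) := by
    ext u
    rw [Pi.mul_apply, ← ENNReal.ofReal_mul (Real.exp_pos _).le, ← Real.exp_add]
    congr 2
    ring
  rw [gibbs, posterior, hμ, lintegral_smul_measure, withDensity_smul_measure,
    ← withDensity_mul _ hqm hWm, lintegral_withDensity_eq_lintegral_mul _ hqm hWm, smul_smul,
    hmul, smul_eq_mul, ENNReal.mul_inv (Or.inl hc0) (Or.inl hct), mul_right_comm,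
    ENNReal.inv_mul_cancel hc0 hct, one_mul]

end GaussianDensity

/-! ### Centred Gaussian measures and their covariance matrices -/

section GaussianMatrix

variable {N : ℕ} {μ : Measure (EuclideanSpace ℝ (Fin N))}

theorem covarianceBilin_eq_dotProduct [IsGaussian μ] {S : Matrix (Fin N) (Fin N) ℝ}
    (hS : ∀ i j, cov[fun x => x i, fun x => x j; μ] = S i j) (v w : EuclideanSpace ℝ (Fin N)) :
    covarianceBilin μ v w = v.ofLp ⬝ᵥ S.mulVec w.ofLp := by
  have hX : ∀ i : Fin N, MemLp (fun x : EuclideanSpace ℝ (Fin N) => x i) 2 μ := fun i =>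
    IsGaussian.memLp_dual μ (EuclideanSpace.proj i) 2 (by simp)
  have h := covarianceBilin_apply_pi hX v w
  have e : (fun x : EuclideanSpace ℝ (Fin N) => WithLp.toLp 2 fun i => x i) = id := rfl
  rw [e, Measure.map_id] at h
  rw [h]
  simp only [hS, dotProduct, Matrix.mulVec, Finset.mul_sum]
  exact Finset.sum_congr rfl fun i _ => Finset.sum_congr rfl fun j _ => by ring

theorem posSemidef_of_covariance [IsGaussian μ] {S : Matrix (Fin N) (Fin N) ℝ}
    (hS : ∀ i j, cov[fun x => x i, fun x => x j; μ] = S i j) : S.PosSemidef := by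
  refine Matrix.PosSemidef.of_dotProduct_mulVec_nonneg ?_ fun v => ?_
  · ext i j
    rw [Matrix.conjTranspose_apply, star_trivial, ← hS, ← hS, covariance_comm]
  · have := covarianceBilin_eq_dotProduct hS (WithLp.toLp 2 v) (WithLp.toLp 2 v)
    rw [star_trivial, ← this]
    exact covarianceBilin_self_nonneg _

/-- A centred Gaussian measure is determined by its covariance matrix. -/
theorem eq_multivariateGaussian [IsGaussian μ] (hm : ∫ x, x ∂μ = 0)
    {S : Matrix (Fin N) (Fin N) ℝ} (hS : ∀ i j, cov[fun x => x i, fun x => x j; μ] = S i j) :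
    μ = multivariateGaussian 0 S := by
  refine IsGaussian.ext (by simp [hm]) ?_
  ext v w
  rw [covarianceBilin_eq_dotProduct hS,
    covarianceBilin_multivariateGaussian (posSemidef_of_covariance hS)]

end GaussianMatrix

/-! ### Conditional laws from an independent additive decomposition -/

section CondLaw

variable {H E : Type*} [MeasurableSpace H] [MeasurableSpace E]

/-- The law of `A u + R`, as a kernel in `u`. -/
noncomputable def shiftKernel [Add H] (A : E → H) (ρ : Measure H) : Kernel E H :=
  (Kernel.id ×ₖ Kernel.const E ρ).map fun p => A p.1 + p.2

theorem shiftKernel_apply [Add H] [MeasurableAdd₂ H] {A : E → H} (hA : Measurable A)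
    (ρ : Measure H) [SFinite ρ] (u : E) : shiftKernel A ρ u = ρ.map fun r => A u + r := by
  have hm : Measurable fun p : E × H => A p.1 + p.2 := by fun_prop
  rw [shiftKernel, Kernel.map_apply _ hm, Kernel.prod_apply, Kernel.id_apply, Kernel.const_apply,
    Measure.dirac_prod, Measure.map_map hm (by fun_prop)]
  rfl

/-- If `F = A (U F) + R F` with `R F` independent of `U F`, then the conditional law of `F` given
`U F = u` is the law of `A u + R F`. -/
theorem isCondLaw_shiftKernel [Add H] [MeasurableAdd₂ H]
    {P : Measure H} [IsProbabilityMeasure P] {U : H → E} {A : E → H} {R : H → H}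
    (hU : Measurable U) (hA : Measurable A) (hR : Measurable R)
    (hind : IndepFun U R P) (hdec : ∀ f, A (U f) + R f = f) (hfib : ∀ u f, U (A u + R f) = u)
    [MeasurableSingletonClass E] :
    IsCondLaw P U (shiftKernel A (P.map R)) := by
  have := Measure.isProbabilityMeasure_map (μ := P) hU.aemeasurable
  have := Measure.isProbabilityMeasure_map (μ := P) hR.aemeasurable
  have hm : Measurable fun p : E × H => A p.1 + p.2 := by fun_prop
  have hM : IsMarkovKernel (shiftKernel A (P.map R)) := by
    unfold shiftKernel
    exact Kernel.IsMarkovKernel.map _ hm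
  refine ⟨hM, ?_, fun u => ?_⟩
  -- By independence `(U, F)` is the image of a product law under `(u, r) ↦ (u, A u + r)`.
  · have h1 : P.map (fun f => (U f, f)) =
        ((P.map U).prod (P.map R)).map fun p => (p.1, A p.1 + p.2) := by
      rw [← (indepFun_iff_map_prod_eq_prod_map_map hU.aemeasurable hR.aemeasurable).1 hind,
        Measure.map_map (by fun_prop) (by fun_prop)]
      congr 1
      ext f
      · rfl
      · exact (hdec f).symm
    rw [h1]
    ext s hs
    have hm2 : Measurable fun p : E × H => (p.1, A p.1 + p.2) := by fun_prop
    rw [Measure.map_apply hm2 hs, Measure.prod_apply (hm2 hs), Measure.compProd_apply hs]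
    refine lintegral_congr fun u => ?_
    rw [shiftKernel_apply hA, Measure.map_apply (by fun_prop) (measurable_prodMk_left hs)]
    rfl
  · have hset : MeasurableSet {f | U f ≠ u} := (hU (measurableSet_singleton u)).compl
    rw [shiftKernel_apply hA, Measure.map_apply (by fun_prop) hset,
      Measure.map_apply hR ((by fun_prop : Measurable fun r => A u + r) hset)]
    convert measure_empty (μ := P)
    ext f
    simp [hfib]

end CondLaw

/-! ### Gaussian regression on finitely many features -/

section Regression

variable {H : Type*} [NormedAddCommGroup H] [InnerProductSpace ℝ H] {M : ℕ}

/-- The features as a continuous linear map. -/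
noncomputable def featuresCLM (h : Fin M → H) : H →L[ℝ] EuclideanSpace ℝ (Fin M) :=
  (EuclideanSpace.equiv (Fin M) ℝ).symm.toContinuousLinearMap ∘L
    ContinuousLinearMap.pi fun m => innerSL ℝ (h m)

theorem featuresCLM_apply (h : Fin M → H) (f : H) : featuresCLM h f = features h f := by
  ext m
  simp [featuresCLM, features, real_inner_comm]

variable [CompleteSpace H] [MeasurableSpace H] [BorelSpace H]

/-- The covariance matrix of the features of a centred measure. -/
noncomputable def featureCov (P : Measure H) (h : Fin M → H) : Matrix (Fin M) (Fin M) ℝ :=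
  Matrix.of fun m m' => ⟪covarianceOperator P (h m), h m'⟫

/-- The conditional mean of `F` given its features, as a continuous linear map. -/
noncomputable def regression (P : Measure H) (h : Fin M → H) : EuclideanSpace ℝ (Fin M) →L[ℝ] H :=
  ∑ m, ((EuclideanSpace.proj m : EuclideanSpace ℝ (Fin M) →L[ℝ] ℝ) ∘L
    Matrix.toEuclideanCLM (𝕜 := ℝ) (featureCov P h)⁻¹).smulRight (covarianceOperator P (h m))

theorem regression_apply (P : Measure H) (h : Fin M → H) (u : EuclideanSpace ℝ (Fin M)) :
    regression P h u = ∑ m, (featureCov P h)⁻¹.mulVec u.ofLp m • covarianceOperator P (h m) := by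
  simp [regression]

/-- `F` minus its conditional mean given the features. -/
noncomputable def residual (P : Measure H) (h : Fin M → H) : H →L[ℝ] H :=
  ContinuousLinearMap.id ℝ H - regression P h ∘L featuresCLM h

theorem residual_apply (P : Measure H) (h : Fin M → H) (f : H) :
    residual P h f = f - regression P h (features h f) := by
  simp [residual, featuresCLM_apply]

theorem inner_covarianceOperator_comm (P : Measure H) (a b : H) :
    ⟪covarianceOperator P a, b⟫ = ⟪covarianceOperator P b, a⟫ := by
  have := (isPositive_covarianceOperator (μ := P)).isSymmetric a b
  simp only [ContinuousLinearMap.coe_coe] at this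
  rw [this, real_inner_comm]

theorem featureCov_transpose (P : Measure H) (h : Fin M → H) :
    (featureCov P h).transpose = featureCov P h := by
  ext m m'
  exact inner_covarianceOperator_comm P _ _

variable {P : Measure H} {h : Fin M → H}

/-- The features of the elements `C h_m` are the columns of the covariance matrix, which cancels the
inverse in `regression`. This puts the conditional laws on the right fibres. -/
theorem features_regression (hG : IsUnit (featureCov P h).det) (u : EuclideanSpace ℝ (Fin M)) :
    features h (regression P h u) = u := by
  ext m
  rw [features, regression_apply]
  simp only [sum_inner, real_inner_smul_left]
  have : (featureCov P h).mulVec ((featureCov P h)⁻¹.mulVec u.ofLp) = u.ofLp := by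
    rw [Matrix.mulVec_mulVec, Matrix.mul_nonsing_inv _ hG, Matrix.one_mulVec]
  conv_rhs => rw [← this]
  rw [Matrix.mulVec, dotProduct]
  refine Finset.sum_congr rfl fun m' _ => ?_
  rw [mul_comm, ← featureCov_transpose]
  rfl

theorem regression_features_covarianceOperator (hG : IsUnit (featureCov P h).det) (m : Fin M) :
    regression P h (features h (covarianceOperator P (h m))) = covarianceOperator P (h m) := by
  have h1 : (features h (covarianceOperator P (h m))).ofLp =
      (featureCov P h).mulVec (Pi.single m 1) := by
    ext m'
    rw [Matrix.mulVec_single_one, Matrix.col_apply, ← featureCov_transpose]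
    rfl
  rw [regression_apply, h1, Matrix.mulVec_mulVec, Matrix.nonsing_inv_mul _ hG, Matrix.one_mulVec]
  simp [Pi.single_apply]

/-- This is the uncorrelatedness of feature and residual: the covariance of `⟨F, h_m⟩` and
`⟨residual F, g⟩` is `⟨residual (C h_m), g⟩`. -/
theorem residual_covarianceOperator (hG : IsUnit (featureCov P h).det) (m : Fin M) :
    residual P h (covarianceOperator P (h m)) = 0 := by
  rw [residual_apply, regression_features_covarianceOperator hG, sub_self]

variable [SecondCountableTopology H]

theorem covariance_inner [IsGaussian P] (hm : ∫ f, f ∂P = 0) (a b : H) :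
    cov[fun f => ⟪f, a⟫, fun f => ⟪f, b⟫; P] = ⟪covarianceOperator P a, b⟫ := by
  have hid : MemLp id 2 P := IsGaussian.memLp_two_id
  have h1 : ∀ c : H, ∫ f, ⟪f, c⟫ ∂P = 0 := fun c => by
    simp_rw [real_inner_comm c]
    rw [integral_inner IsGaussian.integrable_fun_id, hm, inner_zero_right]
  rw [covarianceOperator_inner hid, covariance, h1, h1]
  simp [real_inner_comm]

/-- Both maps are continuous and linear, so the pair is jointly Gaussian and vanishing covariances
suffice. -/
theorem indepFun_features_residual [IsGaussian P] (hm : ∫ f, f ∂P = 0)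
    (hG : IsUnit (featureCov P h).det) : IndepFun (features h) (residual P h) P := by
  have hfe : features h = featuresCLM h := funext fun f => (featuresCLM_apply h f).symm
  have hlaw : HasGaussianLaw (fun f => (features h f, residual P h f)) P := by
    have h0 : HasGaussianLaw (id : H → H) P := IsGaussian.hasGaussianLaw_id
    rw [hfe]
    exact h0.map ((featuresCLM h).prod (residual P h))
  refine hlaw.indepFun_of_covariance_inner fun v g => ?_
  have e1 : (fun f => ⟪v, features h f⟫) = fun f => ⟪f, ∑ m, v m • h m⟫ := by
    ext f
    rw [inner_sum, PiLp.inner_apply]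
    simp [features, real_inner_smul_right, mul_comm]
  have e2 : (fun f => ⟪g, residual P h f⟫) =
      fun f => ⟪f, (residual P h).adjoint g⟫ := by
    ext f
    rw [ContinuousLinearMap.adjoint_inner_right, real_inner_comm]
  rw [e1, e2, covariance_inner hm, ContinuousLinearMap.adjoint_inner_right, map_sum, map_sum]
  simp [residual_covarianceOperator hG]

/-- The conditional law of a centred Gaussian element given finitely many features. -/
theorem isCondLaw_regression [IsGaussian P] (hm : ∫ f, f ∂P = 0)
    (hG : IsUnit (featureCov P h).det) :
    IsCondLaw P (features h) (shiftKernel (regression P h) (P.map (residual P h))) := by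
  have hfe : features h = featuresCLM h := funext fun f => (featuresCLM_apply h f).symm
  refine isCondLaw_shiftKernel ?_ (regression P h).measurable (residual P h).measurable
    (indepFun_features_residual hm hG) (fun f => ?_) (fun u f => ?_)
  · rw [hfe]; exact (featuresCLM h).measurable
  · rw [residual_apply]; abel
  · have h1 := features_regression hG (features h f)
    have h2 := features_regression hG u
    rw [residual_apply]
    simp only [← featuresCLM_apply] at h1 h2 ⊢
    rw [map_add, map_sub, h1, h2]
    simp

theorem map_features_eq [IsGaussian P] (hm : ∫ f, f ∂P = 0) :
    P.map (features h) = multivariateGaussian 0 (featureCov P h) ∧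
      (featureCov P h).PosSemidef := by
  have hfe : features h = featuresCLM h := funext fun f => (featuresCLM_apply h f).symm
  have hmeas : Measurable (features h) := by rw [hfe]; exact (featuresCLM h).measurable
  have hg : IsGaussian (P.map (features h)) := by rw [hfe]; infer_instance
  have hcov : ∀ i j, cov[fun x : EuclideanSpace ℝ (Fin M) => x i, fun x => x j;
      P.map (features h)] = featureCov P h i j := by
    intro i j
    rw [covariance_map (by fun_prop) (by fun_prop) hmeas.aemeasurable]
    exact covariance_inner hm _ _
  refine ⟨eq_multivariateGaussian ?_ hcov, posSemidef_of_covariance hcov⟩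
  rw [hfe, ContinuousLinearMap.integral_id_map IsGaussian.integrable_id]
  simp [hm]

end Regression

/-! ### Weak measurability in separable Hilbert spaces -/

section WeakMeasurability

variable {X H : Type*} [MeasurableSpace X] [NormedAddCommGroup H] [InnerProductSpace ℝ H]
  [TopologicalSpace.SeparableSpace H] [MeasurableSpace H] [BorelSpace H]

/-- A weakly measurable map into a separable Hilbert space is measurable. -/
theorem measurable_of_forall_inner {g : X → H} (hg : ∀ a : H, Measurable fun x => ⟪a, g x⟫) :
    Measurable g := by
  have := UniformSpace.secondCountable_of_separable H
  -- The projections onto these increasing finite-dimensional spaces converge pointwise to the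
  -- identity, and each is a finite sum of inner products.
  let V : ℕ → Submodule ℝ H := fun n =>
    Submodule.span ℝ (TopologicalSpace.denseSeq H '' Set.Iio n)
  have hfin : ∀ n, FiniteDimensional ℝ (V n) := fun n =>
    FiniteDimensional.span_of_finite ℝ ((Set.finite_Iio n).image _)
  have hmono : Monotone V := fun m n hmn =>
    Submodule.span_mono (Set.image_mono (Set.Iio_subset_Iio hmn))
  have htop : ⊤ ≤ (⨆ n, V n).topologicalClosure := by
    intro y _
    have hsub : Set.range (TopologicalSpace.denseSeq H) ⊆ ((⨆ n, V n : Submodule ℝ H) : Set H) := by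
      rintro _ ⟨n, rfl⟩
      -- `Set.Iio n` excludes `n`, so the point with index `n` enters at `V (n + 1)`.
      exact (le_iSup V (n + 1)) (Submodule.subset_span ⟨n, by simp, rfl⟩)
    exact closure_mono hsub (TopologicalSpace.denseRange_denseSeq H y)
  refine measurable_of_tendsto_metrizable (f := fun n x => (V n).starProjection (g x)) (fun n => ?_)
    (tendsto_pi_nhds.2 fun x => Submodule.starProjection_tendsto_self V hmono (g x) htop)
  have e : (fun x => (V n).starProjection (g x)) = fun x =>
      ∑ i, ⟪((stdOrthonormalBasis ℝ (V n) i : V n) : H), g x⟫ •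
        ((stdOrthonormalBasis ℝ (V n) i : V n) : H) := by
    ext x
    rw [(stdOrthonormalBasis ℝ (V n)).starProjection_eq_sum_rankOne]
    simp
  rw [e]
  exact Finset.measurable_sum _ fun i _ => (hg _).smul_const _

end WeakMeasurability

/-! ### Measurability and integral identities for the reproducing kernel -/

section Kernel

variable {X H : Type*} [NormedAddCommGroup H] [InnerProductSpace ℝ H]
  [CompleteSpace H] [RKHS ℝ H X ℝ]

theorem ker_comm (x x' : X) : ker H x x' = ker H x' x := by
  rw [← kerSection_apply, ← kerSection_apply, ← inner_kerSection, ← inner_kerSection,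
    real_inner_comm]

theorem evalAt_eq_features {N : ℕ} (x : Fin N → X) (f : H) :
    evalAt x f = features (fun n => kerSection H (x n)) f := by
  ext n
  simp [evalAt, features, inner_kerSection]

theorem measurable_evalAt [MeasurableSpace H] [BorelSpace H] {N : ℕ} (x : Fin N → X) :
    Measurable (evalAt x : H → EuclideanSpace ℝ (Fin N)) := by
  have : (evalAt x : H → EuclideanSpace ℝ (Fin N)) =
      featuresCLM (fun n => kerSection H (x n)) := by
    ext1 f
    rw [evalAt_eq_features, featuresCLM_apply]
  rw [this]
  exact (featuresCLM _).measurable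

variable [MeasurableSpace X]

theorem gramMat_eigenfunctions {ν : Measure X} {M : ℕ} {e : Fin M → H}
    {lam : Fin M → ℝ} (he : Orthonormal ℝ e) (hlam : ∀ m, covOp ν (e m) = lam m • e m) :
    gramMat ν e = Matrix.diagonal lam := by
  ext m m'
  rw [gramMat, Matrix.of_apply, hlam, real_inner_smul_left, orthonormal_iff_ite.1 he,
    Matrix.diagonal_apply]
  simp

/-- Kernel sections span a dense subspace, and convergence in `H` implies pointwise convergence,
which preserves measurability. -/
theorem measurable_coe_of_measurable_ker (hk : ∀ x : X, Measurable (ker H x)) (f : H) :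
    Measurable f := by
  let S : Submodule ℝ H :=
    { carrier := {f | Measurable f}
      add_mem' := fun {a b} ha hb => by
        simp only [Set.mem_ofPred_eq, RKHS.coe_add] at *
        exact ha.add hb
      zero_mem' := by
        simp only [Set.mem_ofPred_eq, RKHS.coe_zero]
        exact measurable_zero
      smul_mem' := fun c a ha => by
        simp only [Set.mem_ofPred_eq, RKHS.coe_smul] at *
        exact ha.const_smul c }
  have hle : Submodule.span ℝ {RKHS.kerFun H x v | (x : X) (v : ℝ)} ≤ S := by
    rw [Submodule.span_le]
    rintro _ ⟨x, v, rfl⟩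
    have e : RKHS.kerFun H x v = v • kerSection H x := by
      rw [kerSection, ← map_smul, smul_eq_mul, mul_one]
    have hm : Measurable (kerSection H x : H) := by
      have : ⇑(kerSection H x : H) = ker H x := by
        ext z
        rw [kerSection_apply, ker_comm]
      rw [this]
      exact hk x
    rw [e]
    exact S.smul_mem v hm
  have hf : f ∈ (Submodule.span ℝ {RKHS.kerFun H x v | (x : X) (v : ℝ)}).topologicalClosure := by
    rw [RKHS.kerFun_dense]; trivial
  obtain ⟨s, hs, hlim⟩ := mem_closure_iff_seq_limit.1 hf
  refine measurable_of_tendsto_metrizable (f := fun n => ⇑(s n)) (fun n => hle (hs n)) ?_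
  exact ((RKHS.coeCLM ℝ (H := H) (X := X) (V := ℝ)).continuous.tendsto f).comp hlim

variable [TopologicalSpace.SeparableSpace H] [MeasurableSpace H] [BorelSpace H]

theorem measurable_kerSection (hk : ∀ x : X, Measurable (ker H x)) :
    Measurable (kerSection H : X → H) :=
  measurable_of_forall_inner fun a => by
    simp_rw [inner_kerSection]
    exact measurable_coe_of_measurable_ker hk a

/-- The covariance operator on kernel sections gives the smoothed kernel. -/
theorem covOp_kerSection_apply (hk : ∀ x : X, Measurable (ker H x)) (ν : Measure X)
    (hν : Integrable (fun x => ker H x x) ν) (x x' : X) :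
    (covOp ν (kerSection H x) : H) x' = smoothedKer H ν x x' := by
  have := UniformSpace.secondCountable_of_separable H
  have hker := measurable_kerSection hk
  have hsec := measurable_coe_of_measurable_ker hk (kerSection H x : H)
  have hnorm : ∀ z : X, ‖(kerSection H z : H)‖ ^ 2 = ker H z z := fun z => by
    rw [← real_inner_self_eq_norm_sq, inner_kerSection, kerSection_apply]
  -- By Cauchy–Schwarz the integrand has norm at most `‖k_x‖ ‖k_z‖² = ‖k_x‖ k(z, z)`.
  have hint : Integrable (fun z => (kerSection H x : H) z • (kerSection H z : H)) ν := by
    refine (hν.const_mul ‖(kerSection H x : H)‖).mono'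
      (hsec.smul hker).aestronglyMeasurable (ae_of_all _ fun z => ?_)
    rw [norm_smul, ← inner_kerSection, ← hnorm, sq, ← mul_assoc]
    gcongr
    exact norm_inner_le_norm _ _
  rw [← inner_kerSection, covOp, real_inner_comm, ← integral_inner hint, smoothedKer]
  refine integral_congr_ae (ae_of_all _ fun z => ?_)
  simp only
  rw [real_inner_smul_right, real_inner_comm, inner_kerSection, kerSection_apply, kerSection_apply,
    ker_comm z x, ker_comm x' z]

end Kernel

/-! ### Conditional mean and covariance at the inputs -/

section Prior

variable {X H : Type*} [MeasurableSpace X] [NormedAddCommGroup H] [InnerProductSpace ℝ H]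
  [CompleteSpace H] [MeasurableSpace H] [BorelSpace H]
  [RKHS ℝ H X ℝ] {ν : Measure X} {P : Measure H} {N M : ℕ}

theorem IsPrior.featureCov_eq (hP : IsPrior ν P) (h : Fin M → H) :
    featureCov P h = gramMat ν h := by
  ext m m'
  simp only [featureCov, gramMat, Matrix.of_apply, hP.covariance_eq]

theorem IsPrior.inner_covOp_comm (hP : IsPrior ν P) (a b : H) :
    ⟪covOp ν a, b⟫ = ⟪covOp ν b, a⟫ := by
  rw [← hP.covariance_eq, ← hP.covariance_eq, inner_covarianceOperator_comm]

variable [TopologicalSpace.SeparableSpace H]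

theorem IsPrior.covariance_inner (hP : IsPrior ν P) (a b : H) :
    cov[fun f => ⟪f, a⟫, fun f => ⟪f, b⟫; P] = ⟪covOp ν a, b⟫ := by
  have := hP.isGaussian
  have := UniformSpace.secondCountable_of_separable H
  rw [GREApprox.covariance_inner hP.mean_eq_zero, hP.covariance_eq]

theorem IsPrior.covFF_apply (hP : IsPrior ν P) (x : Fin N → X) (n n' : Fin N) :
    covFF P x n n' = ⟪covOp ν (kerSection H (x n)), kerSection H (x n')⟫ := by
  simp only [covFF, Matrix.of_apply, ← hP.covariance_inner, inner_kerSection]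

theorem IsPrior.covFU_apply (hP : IsPrior ν P) (x : Fin N → X) (h : Fin M → H) (n : Fin N)
    (m : Fin M) : covFU P x h n m = ⟪covOp ν (kerSection H (x n)), h m⟫ := by
  simp only [covFU, Matrix.of_apply, ← hP.covariance_inner, inner_kerSection]

theorem IsPrior.covUU_eq (hP : IsPrior ν P) (h : Fin M → H) : covUU P h = gramMat ν h := by
  ext m m'
  simp only [covUU, gramMat, Matrix.of_apply, ← hP.covariance_inner]

theorem IsPrior.evalAt_regression (hP : IsPrior ν P) (x : Fin N → X) (h : Fin M → H)
    (u : EuclideanSpace ℝ (Fin M)) :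
    evalAt x (regression P h u) = WithLp.toLp 2 ((meanMat P x h).mulVec u.ofLp) := by
  ext n
  rw [evalAt, meanMat, ← Matrix.mulVec_mulVec, hP.covUU_eq, regression_apply, hP.featureCov_eq]
  simp only [← inner_kerSection, sum_inner, real_inner_smul_left]
  rw [Matrix.mulVec, dotProduct]
  refine Finset.sum_congr rfl fun m _ => ?_
  rw [hP.covFU_apply, hP.covariance_eq, mul_comm, hP.inner_covOp_comm]

/-- The values of the residual at the inputs have the conditional covariance matrix. -/
theorem IsPrior.covariance_residual (hP : IsPrior ν P) (x : Fin N → X) (h : Fin M → H)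
    (hG : IsUnit (gramMat ν h).det) (n n' : Fin N) :
    cov[fun f => (residual P h f) (x n), fun f => (residual P h f) (x n'); P] =
      condCovMat P x h n n' := by
  set B := meanMat P x h with hB
  set G := gramMat ν h with hGdef
  have hres : ∀ n, (fun f : H => (residual P h f) (x n)) =
      fun f => ⟪f, kerSection H (x n) - ∑ m, B n m • h m⟫ := by
    intro n
    ext f
    have h1 := congrArg (fun v : EuclideanSpace ℝ (Fin N) => v n)
      (hP.evalAt_regression x h (features h f))
    simp only [evalAt] at h1
    rw [residual_apply, RKHS.coe_sub, Pi.sub_apply, h1, inner_sub_right, inner_kerSection,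
      inner_sum, Matrix.mulVec, dotProduct]
    simp only [features, real_inner_smul_right, hB]
  have hBG : B * G = covFU P x h := by
    rw [hB, meanMat, hP.covUU_eq, Matrix.mul_assoc, Matrix.nonsing_inv_mul _ hG, Matrix.mul_one]
  have hBK : B * (covFU P x h).transpose = covFU P x h * G⁻¹ * (covFU P x h).transpose := by
    rw [hB, meanMat, hP.covUU_eq]
  rw [hres, hres, hP.covariance_inner, condCovMat, hP.covUU_eq, ← hGdef, ← hBK,
    ← hP.covariance_eq]
  simp only [map_sub, map_sum, map_smul, inner_sub_left, inner_sub_right, sum_inner, inner_sum,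
    real_inner_smul_left, real_inner_smul_right]
  simp only [hP.covariance_eq, Finset.sum_sub_distrib]
  -- Expanding gives four terms. Since `B * G` is `covFU P x h`, the quadratic term `s3` cancels the
  -- cross term `s1`, and `s2` is the correction in `condCovMat`.
  have s1 : ∑ m, B n' m * ⟪covOp ν (kerSection H (x n)), h m⟫ =
      (B * (covFU P x h).transpose) n' n := by
    rw [Matrix.mul_apply]
    exact Finset.sum_congr rfl fun m _ => by rw [Matrix.transpose_apply, hP.covFU_apply]
  have s2 : ∑ m, B n m * ⟪covOp ν (h m), kerSection H (x n')⟫ =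
      (B * (covFU P x h).transpose) n n' := by
    rw [Matrix.mul_apply]
    exact Finset.sum_congr rfl fun m _ => by
      rw [Matrix.transpose_apply, hP.covFU_apply, hP.inner_covOp_comm]
  have s3 : ∑ m', ∑ m, B n' m' * (B n m * ⟪covOp ν (h m), h m'⟫) =
      (B * (covFU P x h).transpose) n' n := by
    rw [← hBG, Matrix.mul_apply]
    refine Finset.sum_congr rfl fun m' _ => ?_
    rw [Matrix.transpose_apply, Matrix.mul_apply, Finset.mul_sum]
    rfl
  rw [Matrix.sub_apply, hP.covFF_apply, s1, s2, s3]
  ring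

end Prior

/-! ### Almost sure existence of the posterior and identification of the optimum -/

section Posterior

variable {X H : Type*} [NormedAddCommGroup H] [InnerProductSpace ℝ H]
  [CompleteSpace H] [TopologicalSpace.SeparableSpace H] [MeasurableSpace H] [BorelSpace H]
  [RKHS ℝ H X ℝ] {P : Measure H} {N M : ℕ}

/-- For almost every observation the posterior exists and has a finite second moment. -/
theorem ae_isP2_posterior [IsGaussian P] (x : Fin N → X)
    (base : Measure (EuclideanSpace ℝ (Fin N))) [SigmaFinite base]
    {ℓ : EuclideanSpace ℝ (Fin N) → EuclideanSpace ℝ (Fin N) → ℝ}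
    (hℓ : Measurable (Function.uncurry ℓ))
    (hlik : ∀ f : H, ∫⁻ y, ENNReal.ofReal (Real.exp (-ℓ y (evalAt x f))) ∂base = 1) :
    ∀ᵐ y ∂base, IsP2 (posterior P fun f => ℓ y (evalAt x f)) := by
  have := UniformSpace.secondCountable_of_separable H
  have hev := measurable_evalAt (H := H) x
  have hjoint : Measurable fun p : EuclideanSpace ℝ (Fin N) × H =>
      ENNReal.ofReal (Real.exp (-ℓ p.1 (evalAt x p.2))) := by
    have : Measurable fun p : EuclideanSpace ℝ (Fin N) × H => ℓ p.1 (evalAt x p.2) :=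
      hℓ.comp (measurable_fst.prodMk (hev.comp measurable_snd))
    fun_prop
  -- By Tonelli and the normalisation of the likelihood, integrating over `y` returns the prior
  -- integral of `φ`. The weights `1` and `‖f‖²` give the normaliser and the second moment.
  have key : ∀ φ : H → ℝ≥0∞, Measurable φ → ∫⁻ f, φ f ∂P ≠ ∞ →
      ∀ᵐ y ∂base, ∫⁻ f, ENNReal.ofReal (Real.exp (-ℓ y (evalAt x f))) * φ f ∂P < ∞ := by
    intro φ hφ hfin
    have hm : Measurable fun p : EuclideanSpace ℝ (Fin N) × H =>
      ENNReal.ofReal (Real.exp (-ℓ p.1 (evalAt x p.2))) * φ p.2 :=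
      hjoint.mul (hφ.comp measurable_snd)
    refine ae_lt_top (Measurable.lintegral_prod_right' hm) ?_
    rw [lintegral_lintegral_swap hm.aemeasurable]
    have : ∀ f, ∫⁻ y, ENNReal.ofReal (Real.exp (-ℓ y (evalAt x f))) * φ f ∂base = φ f := by
      intro f
      have hy : Measurable fun y => ENNReal.ofReal (Real.exp (-ℓ y (evalAt x f))) :=
        hjoint.comp (measurable_id.prodMk measurable_const)
      rw [lintegral_mul_const _ hy, hlik, one_mul]
    simpa [this] using hfin
  have hsq : ∫⁻ f : H, ‖f‖ₑ ^ 2 ∂P ≠ ∞ := by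
    have hid : MemLp id 2 P := IsGaussian.memLp_two_id
    have := lintegral_rpow_enorm_lt_top_of_eLpNorm_lt_top (by simp) (by simp) hid.2
    simpa using this.ne
  filter_upwards [key 1 measurable_one (by simp), key _ (by fun_prop) hsq] with y h1 h2
  simp only [Pi.one_apply, mul_one] at h1
  have hLm : Measurable fun f : H => ℓ y (evalAt x f) :=
    hℓ.comp (measurable_const.prodMk hev)
  have hLi : Integrable (fun f : H => Real.exp (-ℓ y (evalAt x f))) P := by
    refine ⟨(Real.measurable_exp.comp hLm.neg).aestronglyMeasurable, ?_⟩
    rwa [hasFiniteIntegral_iff_ofReal (ae_of_all _ fun _ => (Real.exp_pos _).le)]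
  refine ⟨?_, ?_⟩
  · rw [posterior_eq_tilted hLi]
    exact isProbabilityMeasure_tilted hLi
  · rw [lintegral_posterior hLm (by fun_prop)]
    refine ENNReal.mul_lt_top ?_ h2
    rw [← ofReal_integral_eq_lintegral_ofReal hLi (ae_of_all _ fun _ => (Real.exp_pos _).le)]
    simpa using integral_exp_pos hLi

variable [MeasurableSpace X] {ν : Measure X}

theorem measurable_gaussPoint (A : Matrix (Fin N) (Fin M) ℝ) (S : Matrix (Fin N) (Fin N) ℝ) :
    Measurable (Function.uncurry (gaussPoint A S)) := by
  have h : Continuous (Function.uncurry (gaussPoint A S)) := by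
    unfold gaussPoint Function.uncurry
    fun_prop
  exact h.measurable

/-- Under the conditional law given the features, the values at the inputs are
distributed as `μ_u + √Σ ξ` with `ξ` standard Gaussian. -/
theorem IsPrior.map_evalAt_condLaw (hP : IsPrior ν P) (x : Fin N → X) (h : Fin M → H)
    (hG : IsUnit (gramMat ν h).det) (u : EuclideanSpace ℝ (Fin M)) :
    (shiftKernel (regression P h) (P.map (residual P h)) u).map (evalAt x) =
      (stdGaussian (EuclideanSpace ℝ (Fin N))).map
        (gaussPoint (meanMat P x h) (condCovMat P x h) u) := by
  have := hP.isGaussian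
  have := UniformSpace.secondCountable_of_separable H
  have hev := measurable_evalAt (H := H) x
  have hR := (residual P h).measurable
  set T := featuresCLM (fun n => kerSection H (x n)) ∘L residual P h with hT
  have hTe : ∀ f, T f = evalAt x (residual P h f) := fun f => by
    rw [hT, ContinuousLinearMap.comp_apply, featuresCLM_apply, evalAt_eq_features]
  have hadd : ∀ f, evalAt x (regression P h u + residual P h f) =
      WithLp.toLp 2 ((meanMat P x h).mulVec u.ofLp) + T f := by
    intro f
    rw [hTe, ← hP.evalAt_regression, evalAt_eq_features, evalAt_eq_features, evalAt_eq_features]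
    simp only [← featuresCLM_apply, map_add]
  have hlaw : P.map T = multivariateGaussian 0 (condCovMat P x h) := by
    refine eq_multivariateGaussian ?_ fun i j => ?_
    · rw [ContinuousLinearMap.integral_id_map IsGaussian.integrable_id]
      simp [hP.mean_eq_zero]
    · rw [covariance_map (by fun_prop) (by fun_prop) T.measurable.aemeasurable,
        ← hP.covariance_residual x h hG i j]
      simp only [Function.comp_def, hTe]
      rfl
  rw [shiftKernel_apply (regression P h).measurable, Measure.map_map hev (by fun_prop),
    Measure.map_map (by fun_prop) hR]
  have e : (evalAt x ∘ fun r => regression P h u + r) ∘ residual P h =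
      (fun v => WithLp.toLp 2 ((meanMat P x h).mulVec u.ofLp) + v) ∘ T := by
    ext1 f
    exact hadd f
  rw [e, ← Measure.map_map (by fun_prop) T.measurable, hlaw, multivariateGaussian,
    Measure.map_map (by fun_prop) (by fun_prop)]
  congr 1
  ext1 ξ
  simp [gaussPoint]

/-- The optimal mixing measure over the conditional laws given general features. -/
theorem IsPrior.isKLArgmin_gibbs (hP : IsPrior ν P) (x : Fin N → X)
    {l : EuclideanSpace ℝ (Fin N) → ℝ} (hl : Measurable l)
    (hR : IsP2 (posterior P fun f => l (evalAt x f))) (h : Fin M → H)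
    (hG : IsUnit (gramMat ν h).det)
    (hfin : FiniteExpectedLoss l (meanMat P x h) (condCovMat P x h)) :
    (∃ κ, IsCondLaw P (features h) κ) ∧ ∀ κ, IsCondLaw P (features h) κ →
      IsP2 (gibbs (potential l (meanMat P x h) (condCovMat P x h) (gramMat ν h))) ∧
      IsKLArgmin (family κ) (posterior P fun f => l (evalAt x f))
        (mixture κ (gibbs (potential l (meanMat P x h) (condCovMat P x h) (gramMat ν h)))) := by
  have := hP.isGaussian
  have := UniformSpace.secondCountable_of_separable H
  have hG' : IsUnit (featureCov P h).det := by rwa [hP.featureCov_eq]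
  have hκ0 := isCondLaw_regression hP.mean_eq_zero hG'
  refine ⟨⟨_, hκ0⟩, fun κ hκ => ?_⟩
  have hfe : features h = featuresCLM h := funext fun f => (featuresCLM_apply h f).symm
  have hU : Measurable (features h) := by rw [hfe]; exact (featuresCLM h).measurable
  have hev := measurable_evalAt (H := H) x
  have hgp := measurable_gaussPoint (meanMat P x h) (condCovMat P x h)
  have hgp' : ∀ u, Measurable (gaussPoint (meanMat P x h) (condCovMat P x h) u) := fun u =>
    hgp.comp (measurable_const.prodMk measurable_id)
  have hC : ∀ f, ‖features h f‖ₑ ≤ ‖featuresCLM h‖₊ * ‖f‖ₑ := fun f => by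
    rw [hfe]
    simp only [enorm_eq_nnnorm]
    exact_mod_cast (featuresCLM h).le_opNNNorm f
  set W : EuclideanSpace ℝ (Fin M) → ℝ := fun u =>
    ∫ ξ, l (gaussPoint (meanMat P x h) (condCovMat P x h) u ξ)
      ∂(stdGaussian (EuclideanSpace ℝ (Fin N))) with hWdef
  have hWm : Measurable W :=
    ((hl.comp hgp).stronglyMeasurable.integral_prod_right').measurable
  have hM0 := hκ0.isMarkov
  have hM := hκ.isMarkov
  have := Measure.isProbabilityMeasure_map (μ := P) hU.aemeasurable
  -- Any conditional law agrees almost everywhere with the explicit one, so fibre means may be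
  -- computed from the latter.
  have hae : κ =ᵐ[P.map (features h)] shiftKernel (regression P h) (P.map (residual P h)) :=
    Kernel.ae_eq_of_compProd_eq (by rw [← hκ.disintegration, ← hκ0.disintegration])
  have hint0 : ∀ u, Integrable (fun f => l (evalAt x f))
      (shiftKernel (regression P h) (P.map (residual P h)) u) := fun u => by
    have h1 := hfin u
    rw [← Function.comp_def, ← integrable_map_measure hl.aestronglyMeasurable
      (hgp' u).aemeasurable, ← hP.map_evalAt_condLaw x h hG u,
      integrable_map_measure hl.aestronglyMeasurable hev.aemeasurable] at h1
    exact h1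
  have hW0 : ∀ u, ∫ f, l (evalAt x f)
      ∂(shiftKernel (regression P h) (P.map (residual P h)) u) = W u := fun u => by
    rw [hWdef]
    simp only
    rw [← integral_map hev.aemeasurable hl.aestronglyMeasurable, hP.map_evalAt_condLaw x h hG u,
      integral_map (hgp' u).aemeasurable hl.aestronglyMeasurable]
  have hmain := isKLArgmin_mixture hU hC hκ (hl.comp hev) hWm
    (hae.mono fun u hu => by rw [hu]; exact hint0 u)
    (hae.mono fun u hu => by rw [hu]; exact hW0 u) hR
  obtain ⟨hlaw, hpsd⟩ := map_features_eq (h := h) hP.mean_eq_zero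
  have hpd : (featureCov P h).PosDef := hpsd.posDef_iff_det_ne_zero.2 hG'.ne_zero
  obtain ⟨c, hc0, hct, hc⟩ := exists_multivariateGaussian_eq_smul hpd
  have hq : Measurable fun u : EuclideanSpace ℝ (Fin M) =>
      1 / 2 * (u.ofLp ⬝ᵥ (featureCov P h)⁻¹.mulVec u.ofLp) := by
    have : Continuous fun u : EuclideanSpace ℝ (Fin M) =>
      u.ofLp ⬝ᵥ (featureCov P h)⁻¹.mulVec u.ofLp := by fun_prop
    fun_prop
  have hgibbs : posterior (P.map (features h)) W =
      gibbs (potential l (meanMat P x h) (condCovMat P x h) (gramMat ν h)) := by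
    rw [posterior_eq_gibbs hWm hq hc0 hct (hlaw.trans hc), hP.featureCov_eq]
    rfl
  rw [hgibbs] at hmain
  exact hmain

variable {e : Fin M → H} {lam : Fin M → ℝ}

/-- Symmetry of `C` moves it onto the eigenfunction: `⟨C k_x, e_m⟩ = ⟨C e_m, k_x⟩ = λ_m e_m(x)`. -/
theorem IsPrior.covFU_eigenfunctions (hP : IsPrior ν P) (x : Fin N → X)
    (hlam : ∀ m, covOp ν (e m) = lam m • e m) :
    covFU P x e = (eigMat e x).transpose * Matrix.diagonal lam := by
  ext n m
  rw [hP.covFU_apply, hP.inner_covOp_comm, hlam, real_inner_smul_left, inner_kerSection,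
    Matrix.mul_diagonal, mul_comm]
  rfl

theorem isUnit_det_diagonal (hpos : ∀ m, 0 < lam m) : IsUnit (Matrix.diagonal lam).det := by
  rw [Matrix.det_diagonal, isUnit_iff_ne_zero]
  exact (Finset.prod_pos fun m _ => hpos m).ne'

theorem IsPrior.meanMat_eigenfunctions (hP : IsPrior ν P) (x : Fin N → X) (he : Orthonormal ℝ e)
    (hpos : ∀ m, 0 < lam m) (hlam : ∀ m, covOp ν (e m) = lam m • e m) :
    meanMat P x e = (eigMat e x).transpose := by
  rw [meanMat, hP.covUU_eq, gramMat_eigenfunctions he hlam, hP.covFU_eigenfunctions x hlam,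
    Matrix.mul_assoc, Matrix.mul_nonsing_inv _ (isUnit_det_diagonal hpos), Matrix.mul_one]

theorem IsPrior.condCovMat_eigenfunctions (hP : IsPrior ν P)
    (hk : ∀ x : X, Measurable (ker H x)) (hν : Integrable (fun x => ker H x x) ν)
    (x : Fin N → X) (he : Orthonormal ℝ e)
    (hpos : ∀ m, 0 < lam m) (hlam : ∀ m, covOp ν (e m) = lam m • e m) :
    condCovMat P x e = eigCovMat ν e lam x := by
  have hFF : covFF P x = Matrix.of fun n n' => smoothedKer H ν (x n) (x n') := by
    ext n n'
    rw [hP.covFF_apply, inner_kerSection, covOp_kerSection_apply hk ν hν, Matrix.of_apply]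
  have hmean := hP.meanMat_eigenfunctions x he hpos hlam
  rw [meanMat] at hmean
  rw [condCovMat, eigCovMat, hFF, hmean, hP.covFU_eigenfunctions x hlam, Matrix.transpose_mul,
    Matrix.diagonal_transpose, Matrix.transpose_transpose, Matrix.mul_assoc]

end Posterior

end GREApprox

/-! ### The theorem, with eigenfunctions as a special case of general features -/

open GREApprox in
theorem theorem1
    {X H : Type*} [MeasurableSpace X]
    [NormedAddCommGroup H] [InnerProductSpace ℝ H] [CompleteSpace H]
    [TopologicalSpace.SeparableSpace H] [MeasurableSpace H] [BorelSpace H]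
    [RKHS ℝ H X ℝ]
    -- kernel `k`, measure `ν` and GRE prior `P = N(0, C)`
    (hk : ∀ x : X, Measurable (ker H x))
    (ν : Measure X) [IsProbabilityMeasure ν]
    (hν : Integrable (fun x => ker H x x) ν)
    (P : Measure H) (hP : IsPrior ν P)
    -- inputs `x₁, …, x_N` and likelihood `p(y | f) = exp (-ℓ_N(y, f(x_{1:N})))` w.r.t. `base`
    {N : ℕ} (x : Fin N → X)
    (base : Measure (EuclideanSpace ℝ (Fin N))) [SigmaFinite base]
    (ℓ : EuclideanSpace ℝ (Fin N) → EuclideanSpace ℝ (Fin N) → ℝ)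
    (hℓ : Measurable (Function.uncurry ℓ))
    (hlik : ∀ f : H, ∫⁻ y, ENNReal.ofReal (Real.exp (-ℓ y (evalAt x f))) ∂base = 1) :
    -- for almost every observation the posterior exists and has a finite second moment
    (∀ᵐ y ∂base, IsP2 (posterior P fun f => ℓ y (evalAt x f))) ∧
    -- and for every such observation the following holds
    ∀ y, IsP2 (posterior P fun f => ℓ y (evalAt x f)) →
      -- the leading Karhunen-Loeve coefficients as features
      (∀ (M : ℕ) (e : Fin M → H) (lam : Fin M → ℝ), Orthonormal ℝ e →
        (∀ m, 0 < lam m) → (∀ m, covOp ν (e m) = lam m • e m) →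
        FiniteExpectedLoss (ℓ y) (eigMat e x).transpose (eigCovMat ν e lam x) →
        (∃ κ, IsCondLaw P (features e) κ) ∧
        ∀ κ, IsCondLaw P (features e) κ →
          let τ := gibbs (potential (ℓ y) (eigMat e x).transpose (eigCovMat ν e lam x)
            (Matrix.diagonal lam))
          IsP2 τ ∧
          IsKLArgmin (family κ) (posterior P fun f => ℓ y (evalAt x f)) (mixture κ τ)) ∧
      -- general features `U = (⟨F, h₁⟩, …, ⟨F, h_M⟩)` with invertible covariance matrix
      (∀ (M : ℕ) (h : Fin M → H), IsUnit (gramMat ν h).det →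
        FiniteExpectedLoss (ℓ y) (meanMat P x h) (condCovMat P x h) →
        (∃ κ, IsCondLaw P (features h) κ) ∧
        ∀ κ, IsCondLaw P (features h) κ →
          let τ := gibbs (potential (ℓ y) (meanMat P x h) (condCovMat P x h) (gramMat ν h))
          IsP2 τ ∧
          IsKLArgmin (family κ) (posterior P fun f => ℓ y (evalAt x f)) (mixture κ τ)) := by
  have := hP.isGaussian
  refine ⟨ae_isP2_posterior x base hℓ hlik, fun y hy => ?_⟩
  have hl : Measurable (ℓ y) := hℓ.comp (measurable_const.prodMk measurable_id)
  refine ⟨fun M e lam he hpos hlam hfin => ?_, fun M h hG hfin =>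
    hP.isKLArgmin_gibbs x hl hy h hG hfin⟩
  have hmean := hP.meanMat_eigenfunctions x he hpos hlam
  have hcov := hP.condCovMat_eigenfunctions hk hν x he hpos hlam
  have hgram := gramMat_eigenfunctions he hlam
  rw [← hmean, ← hcov] at hfin ⊢
  rw [← hgram]
  exact hP.isKLArgmin_gibbs x hl hy e (by rw [hgram]; exact isUnit_det_diagonal hpos) hfin
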